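/- Let $A,B,C,D$ be real polynomials in two variables with $C(0,0)=D(0,0)=0$, and consider for small $\varepsilon$ the planar system $$\dot x=A(x^2,y)+\varepsilon\,C(x,y),\qquad \dot y=x\,B(x^2,y)+\varepsilon\,D(x,y). \tag{$*_\varepsilon$}$$ Assume that $x^2B(x^2,y)-y\,A(x^2,y)$, which gives the sign of $\dot\theta$ for $(*_0)$, does not vanish in some punctured neighbourhood of the origin. Notation. For a polynomial $H(x,y)$ let $H_0,H_1\in\mathbb R[f,g,u]$ be the unique polynomials with $H\big((f+vg)v,(f+vg)u\big)=H_0(f,g,u)+v\,H_1(f,g,u)$ modulo $v^2=1-u^2$. For a polynomial $K$ put $K_{0,0}(f,u)=K\big((1-u^2)f^2,uf\big)$; if $H(x,y)=K(x^2,y)$, then $H_1$ is divisible by $g$, and $K_{1,0}\in\mathbb R[f,g,u]$ is defined by $H_1=g\,K_{1,0}$. For $\rho>0$ let $f_\rho$ be the solution of $$f'=\frac{(A_{0,0}+u\,B_{0,0}f)\,f}{(1-u^2)B_{0,0}f-u\,A_{0,0}},\qquad f(0)=\rho,$$ where $A_{0,0}=A_{0,0}(f,u)$ and $B_{0,0}=B_{0,0}(f,u)$.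 Suppose that $f_\rho$ is defined and positive on $[-1,1]$, that the denominator does not vanish along it there, and that the curve with polar equation $r=f_\rho(\sin\theta)$, which passes through the point $(x,y)=(\rho,0)$, is a (star-like) periodic orbit of $(*_0)$. For such $\rho$ define $$N(\rho)=\int_{-1}^{1}M_\rho(u)\,e^{-\int_0^uL_\rho(s)\,ds}\,du,$$ $$L_\rho(u)=\frac{S_\rho(u)}{(1-u^2)\big(uA_{0,0}-(1-u^2)B_{0,0}f_\rho(u)\big)^2},\qquad M_\rho(u)=\frac{-f_\rho(u)\big(A_{0,0}D_0-(1-u^2)B_{0,0}C_1f_\rho(u)\big)}{(1-u^2)\big(uA_{0,0}-(1-u^2)B_{0,0}f_\rho(u)\big)^2},$$ $$S_\rho(u)=(1-u^2)\big(A_{1,0}B_{0,0}-A_{0,0}B_{1,0}+2u(1-u^2)B_{0,0}^2\big)f_\rho^2(u)-4u^2(1-u^2)A_{0,0}B_{0,0}f_\rho(u)-u(1-2u^2)A_{0,0}^2,$$ where $A_{0,0},B_{0,0}$ are evaluated at $(f,u)=(f_\rho(u),u)$ and $A_{1,0},B_{1,0},C_1,D_0$ at $(f,g,u)=(f_\rho(u),0,u)$.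 Let $\rho_0>0$ be such a value. Suppose that for some $\varepsilon_0>0$ there is a continuous function $r(\theta,\varepsilon)>0$ on $\mathbb R\times(0,\varepsilon_0)$, $2\pi$-periodic in $\theta$, such that for every $\varepsilon\in(0,\varepsilon_0)$ the curve $r=r(\theta,\varepsilon)$ is a limit cycle (a periodic orbit isolated among the periodic orbits) of $(*_\varepsilon)$, and that $r(0,\varepsilon)\to\rho_0$ as $\varepsilon\to0^+$. Then the integrals defining $N(\rho_0)$ converge (those in the exponent for $|u|<1$), and $N(\rho_0)=0$. -/

import Mathlib

open Set Filter Topology MeasureTheory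

namespace RevCenter

/-! ## Planar systems, periodic orbits, limit cycles -/

/-- `Γ` is a periodic orbit of the planar system `ṗ = V p`: the image of a nonconstant
periodic solution. -/
def IsPeriodicOrbit (V : ℝ × ℝ → ℝ × ℝ) (Γ : Set (ℝ × ℝ)) : Prop :=
  ∃ γ : ℝ → ℝ × ℝ, (∀ t, HasDerivAt γ (V (γ t)) t) ∧
    (∃ τ : ℝ, 0 < τ ∧ Function.Periodic γ τ) ∧ (∃ t, γ t ≠ γ 0) ∧ range γ = Γ

/-- A limit cycle: a periodic orbit that is isolated in the set of periodic orbits. -/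
def IsLimitCycle (V : ℝ × ℝ → ℝ × ℝ) (Γ : Set (ℝ × ℝ)) : Prop :=
  IsPeriodicOrbit V Γ ∧
    ∃ U : Set (ℝ × ℝ), IsOpen U ∧ Γ ⊆ U ∧ ∀ Γ', IsPeriodicOrbit V Γ' → Γ' ⊆ U → Γ' = Γ

/-- The planar curve with polar equation `r = r(θ)`. -/
def polarCurve (r : ℝ → ℝ) : Set (ℝ × ℝ) :=
  range fun θ : ℝ => (r θ * Real.cos θ, r θ * Real.sin θ)

/-- The vector field `(A(x²,y) + ε C(x,y), x B(x²,y) + ε D(x,y))`. -/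
noncomputable def field (A B C D : MvPolynomial (Fin 2) ℝ) (ε : ℝ) (p : ℝ × ℝ) : ℝ × ℝ :=
  (MvPolynomial.eval ![p.1 ^ 2, p.2] A + ε * MvPolynomial.eval ![p.1, p.2] C,
    p.1 * MvPolynomial.eval ![p.1 ^ 2, p.2] B + ε * MvPolynomial.eval ![p.1, p.2] D)

/-! ## The decomposition `H((f+vg)v, (f+vg)u) = H₀(f,g,u) + v H₁(f,g,u)`, `v² = 1 - u²`

The variables `f, g, u` are `X 0, X 1, X 2` of `MvPolynomial (Fin 3) ℝ`. -/

/-- `H((f+vg)v, (f+vg)u)` as a polynomial in `v` with coefficients in `ℝ[f,g,u]`. -/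
noncomputable def subst (H : MvPolynomial (Fin 2) ℝ) : Polynomial (MvPolynomial (Fin 3) ℝ) :=
  MvPolynomial.aeval
    ![(Polynomial.C (MvPolynomial.X 0) + Polynomial.X * Polynomial.C (MvPolynomial.X 1)) *
        Polynomial.X,
      (Polynomial.C (MvPolynomial.X 0) + Polynomial.X * Polynomial.C (MvPolynomial.X 1)) *
        Polynomial.C (MvPolynomial.X 2)] H

/-- `H₀`: the even powers `v^(2k)` are replaced by `(1-u²)^k`. -/
noncomputable def part0 (H : MvPolynomial (Fin 2) ℝ) : MvPolynomial (Fin 3) ℝ :=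
  ∑ k ∈ Finset.range ((subst H).natDegree + 1),
    (subst H).coeff (2 * k) * (1 - MvPolynomial.X 2 ^ 2) ^ k

/-- `H₁`: the odd powers `v^(2k+1)` are replaced by `v (1-u²)^k`. -/
noncomputable def part1 (H : MvPolynomial (Fin 2) ℝ) : MvPolynomial (Fin 3) ℝ :=
  ∑ k ∈ Finset.range ((subst H).natDegree + 1),
    (subst H).coeff (2 * k + 1) * (1 - MvPolynomial.X 2 ^ 2) ^ k

/-- The polynomial `K(x²,y)`. -/
noncomputable def sqSubst (K : MvPolynomial (Fin 2) ℝ) : MvPolynomial (Fin 2) ℝ :=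
  MvPolynomial.aeval ![MvPolynomial.X 0 ^ 2, MvPolynomial.X 1] K

/-- `K_{0,0}(f,u) = K((1-u²)f², uf)`. -/
noncomputable def K00 (K : MvPolynomial (Fin 2) ℝ) (f u : ℝ) : ℝ :=
  MvPolynomial.eval ![(1 - u ^ 2) * f ^ 2, u * f] K

/-- `K_{1,0}(f,g,u)`, the quotient by `g` of `H₁` for `H(x,y) = K(x²,y)`; the division is exact
by `X_mul_K10`. -/
noncomputable def K10 (K : MvPolynomial (Fin 2) ℝ) : MvPolynomial (Fin 3) ℝ :=
  (part1 (sqSubst K)).divMonomial (Finsupp.single 1 1)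

theorem sum_range_two_mul {M : Type*} [AddCommMonoid M] (a : ℕ → M) (n : ℕ) :
    ∑ i ∈ Finset.range (2 * n), a i =
      ∑ k ∈ Finset.range n, a (2 * k) + ∑ k ∈ Finset.range n, a (2 * k + 1) := by
  induction n with
  | zero => simp
  | succ n ih =>
    rw [show 2 * (n + 1) = 2 * n + 1 + 1 by ring, Finset.sum_range_succ, Finset.sum_range_succ, ih,
      Finset.sum_range_succ, Finset.sum_range_succ]
    abel

/-- The defining identity `H = H₀ + v H₁`. -/
theorem eval_decomposition (H : MvPolynomial (Fin 2) ℝ) (f g u v : ℝ) (hv : v ^ 2 = 1 - u ^ 2) :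
    MvPolynomial.eval ![(f + v * g) * v, (f + v * g) * u] H =
      MvPolynomial.eval ![f, g, u] (part0 H) + v * MvPolynomial.eval ![f, g, u] (part1 H) := by
  have h1 : MvPolynomial.eval ![(f + v * g) * v, (f + v * g) * u] H =
      (subst H).eval₂ (MvPolynomial.eval ![f, g, u]) v := by
    induction H using MvPolynomial.induction_on with
    | C a =>
      simp only [subst, MvPolynomial.algHom_C, MvPolynomial.eval_C,
        Polynomial.algebraMap_apply, MvPolynomial.algebraMap_eq, Polynomial.eval₂_C]
    | add p q hp hq =>
      simp only [subst, map_add, Polynomial.eval₂_add] at *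
      rw [hp, hq]
    | mul_X p i hp =>
      simp only [subst, map_mul, Polynomial.eval₂_mul] at *
      rw [hp]
      congr 1
      fin_cases i <;>
        simp [Polynomial.eval₂_add, Polynomial.eval₂_mul, mul_comm v g]
  rw [h1, Polynomial.eval₂_eq_sum_range' _ (n := 2 * ((subst H).natDegree + 1)) (by omega),
    sum_range_two_mul, part0, part1, map_sum, map_sum, Finset.mul_sum]
  congr 1
  · refine Finset.sum_congr rfl fun k _ => ?_
    simp [pow_mul, hv]
  · refine Finset.sum_congr rfl fun k _ => ?_
    simp only [map_mul, map_pow, map_sub, map_one, MvPolynomial.eval_X]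
    simp [pow_succ v (2 * k), pow_mul v 2 k, hv]
    ring

/-- The identity `H₁ = g K_{1,0}` for `H(x,y) = K(x²,y)`. -/
theorem X_mul_K10 (K : MvPolynomial (Fin 2) ℝ) :
    MvPolynomial.X 1 * K10 K = part1 (sqSubst K) := by
  let e : MvPolynomial (Fin 3) ℝ →ₐ[ℝ] MvPolynomial (Fin 3) ℝ :=
    MvPolynomial.aeval ![MvPolynomial.X 0, 0, MvPolynomial.X 2]
  have hdvd : ∀ p : MvPolynomial (Fin 3) ℝ, MvPolynomial.X 1 ∣ p - e p := by
    intro p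
    induction p using MvPolynomial.induction_on with
    | C a => simp [e]
    | add p q hp hq =>
      rw [map_add, add_sub_add_comm]
      exact dvd_add hp hq
    | mul_X p i hp =>
      have hi : (MvPolynomial.X 1 : MvPolynomial (Fin 3) ℝ) ∣
          MvPolynomial.X i - e (MvPolynomial.X i) := by
        fin_cases i <;> simp [e]
      have : p * MvPolynomial.X i - e (p * MvPolynomial.X i) =
          (p - e p) * MvPolynomial.X i +
            e p * (MvPolynomial.X i - e (MvPolynomial.X i)) := by
        rw [map_mul]; ring
      rw [this]
      exact dvd_add (hp.mul_right _) (hi.mul_left _)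
  have hmap : ∃ Q : Polynomial (MvPolynomial (Fin 3) ℝ),
      (subst (sqSubst K)).map (e : MvPolynomial (Fin 3) ℝ →+* MvPolynomial (Fin 3) ℝ) =
        Polynomial.expand _ 2 Q := by
    induction K using MvPolynomial.induction_on with
    | C a =>
      refine ⟨Polynomial.C (MvPolynomial.C a), ?_⟩
      simp [subst, sqSubst, e, Polynomial.algebraMap_apply, MvPolynomial.algebraMap_eq]
    | add p q hp hq =>
      obtain ⟨P, hP⟩ := hp
      obtain ⟨Q, hQ⟩ := hq
      refine ⟨P + Q, ?_⟩
      simp only [subst, sqSubst, map_add, Polynomial.map_add] at *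
      rw [hP, hQ]
    | mul_X p i hp =>
      obtain ⟨P, hP⟩ := hp
      simp only [subst, sqSubst, map_mul, Polynomial.map_mul] at *
      have h0 : e (MvPolynomial.X 0) = MvPolynomial.X 0 := by simp [e]
      have h1 : e (MvPolynomial.X 1) = 0 := by simp [e]
      have h2 : e (MvPolynomial.X 2) = MvPolynomial.X 2 := by simp [e]
      have key : ∃ R : Polynomial (MvPolynomial (Fin 3) ℝ),
          (subst (sqSubst (MvPolynomial.X i))).map
            (e : MvPolynomial (Fin 3) ℝ →+* MvPolynomial (Fin 3) ℝ) =
              Polynomial.expand _ 2 R := by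
        clear_value e
        fin_cases i
        · refine ⟨Polynomial.C (MvPolynomial.X 0 ^ 2) * Polynomial.X, ?_⟩
          simp [subst, sqSubst, h0, h1, mul_pow]
        · refine ⟨Polynomial.C (MvPolynomial.X 0 * MvPolynomial.X 2), ?_⟩
          simp [subst, sqSubst, h0, h1, h2]
      obtain ⟨R, hR⟩ := key
      refine ⟨P * R, ?_⟩
      simp only [subst, sqSubst] at hR
      rw [hP, hR, map_mul]
  obtain ⟨Q, hQ⟩ := hmap
  have he : e (part1 (sqSubst K)) = 0 := by
    rw [part1, map_sum]
    refine Finset.sum_eq_zero fun k _ => ?_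
    have hc : e ((subst (sqSubst K)).coeff (2 * k + 1)) = 0 := by
      have := congrArg (fun P => Polynomial.coeff P (2 * k + 1)) hQ
      simp only [Polynomial.coeff_map] at this
      rw [Polynomial.coeff_expand (by norm_num), if_neg (by omega)] at this
      exact this
    rw [map_mul, hc, zero_mul]
  have h := hdvd (part1 (sqSubst K))
  rw [he, sub_zero] at h
  obtain ⟨q, hq⟩ := h
  rw [K10, hq, MvPolynomial.X_mul_divMonomial]

/-! ## The unperturbed orbit and the function `N` -/

/-- `f` solves on `[-1,1]` the initial value problem
`f' = (A₀₀ + u B₀₀ f) f / ((1-u²) B₀₀ f - u A₀₀)`, `f(0) = ρ`, and the denominator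
does not vanish along the solution. -/
def IsUnperturbedSolution (A B : MvPolynomial (Fin 2) ℝ) (ρ : ℝ) (f : ℝ → ℝ) : Prop :=
  f 0 = ρ ∧ ∀ u ∈ Icc (-1 : ℝ) 1,
    (1 - u ^ 2) * K00 B (f u) u * f u - u * K00 A (f u) u ≠ 0 ∧
    HasDerivWithinAt f
      ((K00 A (f u) u + u * K00 B (f u) u * f u) * f u /
        ((1 - u ^ 2) * K00 B (f u) u * f u - u * K00 A (f u) u)) (Icc (-1) 1) u

/-- The function `S_ρ(u)`, for `f = f_ρ`. -/
noncomputable def Sfun (A B : MvPolynomial (Fin 2) ℝ) (f : ℝ → ℝ) (u : ℝ) : ℝ :=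
  let A00 := K00 A (f u) u;
  let B00 := K00 B (f u) u;
  let A10 := MvPolynomial.eval ![f u, 0, u] (K10 A);
  let B10 := MvPolynomial.eval ![f u, 0, u] (K10 B);
  (1 - u ^ 2) * (A10 * B00 - A00 * B10 + 2 * u * (1 - u ^ 2) * B00 ^ 2) * f u ^ 2
    - 4 * u ^ 2 * (1 - u ^ 2) * A00 * B00 * f u - u * (1 - 2 * u ^ 2) * A00 ^ 2

/-- The function `L_ρ(u)`, for `f = f_ρ`. -/
noncomputable def Lfun (A B : MvPolynomial (Fin 2) ℝ) (f : ℝ → ℝ) (u : ℝ) : ℝ :=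
  Sfun A B f u /
    ((1 - u ^ 2) * (u * K00 A (f u) u - (1 - u ^ 2) * K00 B (f u) u * f u) ^ 2)

/-- The function `M_ρ(u)`, for `f = f_ρ`. -/
noncomputable def Mfun (A B C D : MvPolynomial (Fin 2) ℝ) (f : ℝ → ℝ) (u : ℝ) : ℝ :=
  let A00 := K00 A (f u) u;
  let B00 := K00 B (f u) u;
  let C1 := MvPolynomial.eval ![f u, 0, u] (part1 C);
  let D0 := MvPolynomial.eval ![f u, 0, u] (part0 D);
  -(f u) * (A00 * D0 - (1 - u ^ 2) * B00 * C1 * f u) /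
    ((1 - u ^ 2) * (u * A00 - (1 - u ^ 2) * B00 * f u) ^ 2)

/-- The integrand `M_ρ(u) exp(-∫₀ᵘ L_ρ)` of `N(ρ)`. -/
noncomputable def integrand (A B C D : MvPolynomial (Fin 2) ℝ) (f : ℝ → ℝ) (u : ℝ) : ℝ :=
  Mfun A B C D f u * Real.exp (-∫ s in (0 : ℝ)..u, Lfun A B f s)

/-- `N(ρ) = ∫_{-1}^{1} M_ρ(u) exp(-∫₀ᵘ L_ρ) du`, for `f = f_ρ`. -/
noncomputable def Nfun (A B C D : MvPolynomial (Fin 2) ℝ) (f : ℝ → ℝ) : ℝ :=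
  ∫ u in (-1 : ℝ)..1, integrand A B C D f u

end RevCenter

/-! The unperturbed system is reversible under `x ↦ -x`, that is, under `θ ↦ π - θ`. In polar
coordinates its trajectories satisfy `dr/dθ = cos θ · G(r, sin θ, cos θ)` with `G` even in `cos θ`;
the perturbation adds `ε` times a regular term (`field_polar`).

For a periodic orbit `r(θ)` of the perturbed system put `z(θ) = r(θ) - r(π - θ)`. The unperturbed
parts combine into a divided difference (`exists_slope`), so `z' = a z + ε b` exactly, where `b`
adds the perturbation terms at `θ` and `π - θ`. Since `z` vanishes at `π/2` by symmetry and at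
`-π/2` by periodicity, the integrating factor gives `∫ b exp(-∫ a) = 0` for every small `ε > 0`
(`integral_mul_exp_eq_zero`); no expansion in `ε` is needed.

Grönwall's inequality in a tube (`eventually_forall_abs_lt`) upgrades `r(0, ε) → ρ₀` to uniform
convergence to `f (sin θ)`, so the identity passes to the limit (`integral_pertEven_eq_zero`). With
`u = sin θ` the limit integral is `2 N(ρ₀)`; the singularities of `L` and `M` at `u = ±1` are
cancelled by powers of `cos θ` (`Nfun_eq`). -/

namespace RevCenter

/-! ### Star-like periodic orbits in polar coordinates -/

/-- Where the angular speed does not vanish, a periodic orbit `r = ρ(θ)` satisfies the equation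
of the trajectories in polar coordinates. -/
theorem hasDerivAt_polarCurve {V : ℝ × ℝ → ℝ × ℝ} (hV : Continuous V) {ρ : ℝ → ℝ}
    (hpos : ∀ θ, 0 < ρ θ) (hper : Function.Periodic ρ (2 * Real.pi))
    (horb : IsPeriodicOrbit V (polarCurve ρ)) (θ : ℝ)
    (hd : (V (ρ θ * Real.cos θ, ρ θ * Real.sin θ)).2 * Real.cos θ -
      (V (ρ θ * Real.cos θ, ρ θ * Real.sin θ)).1 * Real.sin θ ≠ 0) :
    HasDerivAt ρ (ρ θ * ((V (ρ θ * Real.cos θ, ρ θ * Real.sin θ)).1 * Real.cos θ +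
        (V (ρ θ * Real.cos θ, ρ θ * Real.sin θ)).2 * Real.sin θ) /
      ((V (ρ θ * Real.cos θ, ρ θ * Real.sin θ)).2 * Real.cos θ -
        (V (ρ θ * Real.cos θ, ρ θ * Real.sin θ)).1 * Real.sin θ)) θ := by
  obtain ⟨γ, hγ, -, -, hrange⟩ := horb
  obtain ⟨t₀, ht₀⟩ : (ρ θ * Real.cos θ, ρ θ * Real.sin θ) ∈ range γ := by
    rw [hrange]; exact ⟨θ, rfl⟩
  rw [← ht₀] at hd ⊢
  set c := Real.cos θ with hc
  set s := Real.sin θ with hs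
  have hcs : c ^ 2 + s ^ 2 = 1 := Real.cos_sq_add_sin_sq θ
  have hγc : Continuous γ := continuous_iff_continuousAt.2 fun t => (hγ t).continuousAt
  have hst : HasStrictDerivAt γ (V (γ t₀)) t₀ :=
    hasStrictDerivAt_of_hasDerivAt_of_continuousAt (Eventually.of_forall hγ)
      (hV.comp hγc).continuousAt
  have h1 : HasStrictDerivAt (fun t => (γ t).1) (V (γ t₀)).1 t₀ := hst.fst
  have h2 : HasStrictDerivAt (fun t => (γ t).2) (V (γ t₀)).2 t₀ := hst.snd
  set a := (V (γ t₀)).1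
  set b := (V (γ t₀)).2
  -- Coordinates rotated by `θ`, so that the orbit at time `t₀` lies on the positive `X`-axis and `θ
  -- + arctan (Y / X)` is a polar angle nearby.
  let X : ℝ → ℝ := fun t => (γ t).1 * c + (γ t).2 * s
  let Y : ℝ → ℝ := fun t => (γ t).2 * c - (γ t).1 * s
  have hX : HasStrictDerivAt X (a * c + b * s) t₀ := (h1.mul_const c).add (h2.mul_const s)
  have hY : HasStrictDerivAt Y (b * c - a * s) t₀ := (h2.mul_const c).sub (h1.mul_const s)
  have hX0 : X t₀ = ρ θ := by
    simp only [X, ht₀]; linear_combination ρ θ * hcs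
  have hY0 : Y t₀ = 0 := by
    simp only [Y, ht₀]; ring
  have hρ : ρ θ ≠ 0 := (hpos θ).ne'
  have hφ : HasStrictDerivAt (fun t => θ + Real.arctan (Y t / X t)) ((b * c - a * s) / ρ θ) t₀ := by
    have := ((hY.div hX (by rw [hX0]; exact hρ)).arctan).const_add θ
    refine this.congr_deriv ?_
    simp only [Pi.div_apply, hX0, hY0]
    field_simp
    ring
  have hφ' : (b * c - a * s) / ρ θ ≠ 0 := div_ne_zero hd hρ
  have hφ0 : θ + Real.arctan (Y t₀ / X t₀) = θ := by simp [hY0]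
  -- Time as a function of the angle, from the inverse function theorem; this is why strict
  -- derivatives are used.
  let τ := hφ.localInverse _ _ _ hφ'
  have hτ : HasStrictDerivAt τ ((b * c - a * s) / ρ θ)⁻¹ θ := by
    have := hφ.to_localInverse hφ'
    rwa [hφ0] at this
  have hτθ : τ θ = t₀ := by
    have := (hφ.hasStrictFDerivAt_equiv hφ').localInverse_apply_image
    simp only [hφ0] at this
    exact this
  have hright : ∀ᶠ θ' in 𝓝 θ, θ + Real.arctan (Y (τ θ') / X (τ θ')) = θ' := by
    have := (hφ.hasStrictFDerivAt_equiv hφ').eventually_right_inverse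
    rwa [hφ0] at this
  have hXpos : ∀ᶠ θ' in 𝓝 θ, 0 < X (τ θ') := by
    have h : ContinuousAt (fun θ' => X (τ θ')) θ :=
      ContinuousAt.comp (g := X) (f := τ) (by rw [hτθ]; exact hX.hasDerivAt.continuousAt)
        hτ.hasDerivAt.continuousAt
    refine h.eventually_const_lt ?_
    simp only [hτθ, hX0]
    exact hpos θ
  -- No regularity of `ρ` is assumed; it is recovered from `γ`. The point `γ (τ θ')` has radius `ρ
  -- ψ` for some `ψ`. Both `ψ - θ` and `θ' - θ` have positive cosine and the same tangent, so `ψ`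
  -- and `θ'` agree modulo `2π`.
  have hev : ρ =ᶠ[𝓝 θ] fun θ' => √(X (τ θ') ^ 2 + Y (τ θ') ^ 2) := by
    filter_upwards [hright, hXpos] with θ' hr hx
    obtain ⟨ψ, hψ⟩ : γ (τ θ') ∈ polarCurve ρ := by rw [← hrange]; exact mem_range_self _
    have e1 : (γ (τ θ')).1 = ρ ψ * Real.cos ψ := by rw [← hψ]
    have e2 : (γ (τ θ')).2 = ρ ψ * Real.sin ψ := by rw [← hψ]
    have eX : X (τ θ') = ρ ψ * Real.cos (ψ - θ) := by
      simp only [X, e1, e2, Real.cos_sub]; ring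
    have eY : Y (τ θ') = ρ ψ * Real.sin (ψ - θ) := by
      simp only [Y, e1, e2, Real.sin_sub]; ring
    have hψp := hpos ψ
    have hnorm : √(X (τ θ') ^ 2 + Y (τ θ') ^ 2) = ρ ψ := by
      rw [show X (τ θ') ^ 2 + Y (τ θ') ^ 2 = ρ ψ ^ 2 by
        rw [eX, eY]; linear_combination ρ ψ ^ 2 * Real.cos_sq_add_sin_sq (ψ - θ)]
      exact Real.sqrt_sq hψp.le
    have hcos : 0 < Real.cos (ψ - θ) := by
      rw [eX] at hx
      exact (mul_pos_iff_of_pos_left hψp).1 hx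
    have htan : Real.tan (θ' - θ) = Real.tan (ψ - θ) := by
      have : θ' - θ = Real.arctan (Y (τ θ') / X (τ θ')) := by linarith
      rw [this, Real.tan_arctan, eX, eY, mul_div_mul_left _ _ hψp.ne', Real.tan_eq_sin_div_cos]
    have hcos' : 0 < Real.cos (θ' - θ) := by
      have : θ' - θ = Real.arctan (Y (τ θ') / X (τ θ')) := by linarith
      rw [this]; exact Real.cos_arctan_pos _
    have hsin0 : Real.sin (θ' - ψ) = 0 := by
      rw [Real.tan_eq_sin_div_cos, Real.tan_eq_sin_div_cos, div_eq_div_iff hcos'.ne' hcos.ne'] at htan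
      rw [show θ' - ψ = (θ' - θ) - (ψ - θ) by ring, Real.sin_sub]
      linarith
    have hcos1 : 0 < Real.cos (θ' - ψ) := by
      have e3 : Real.cos (θ' - ψ) = Real.cos (θ' - θ) * Real.cos (ψ - θ) +
          Real.sin (θ' - θ) * Real.sin (ψ - θ) := by
        rw [← Real.cos_sub]; congr 1; ring
      have e4 : Real.sin (θ' - θ) * Real.cos (ψ - θ) = Real.sin (ψ - θ) * Real.cos (θ' - θ) := by
        rwa [Real.tan_eq_sin_div_cos, Real.tan_eq_sin_div_cos,
          div_eq_div_iff hcos'.ne' hcos.ne'] at htan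
      have e5 : Real.cos (θ' - ψ) * Real.cos (ψ - θ) = Real.cos (θ' - θ) := by
        rw [e3]
        linear_combination Real.sin (ψ - θ) * e4 +
          Real.cos (θ' - θ) * Real.sin_sq_add_cos_sq (ψ - θ)
      exact (mul_pos_iff_of_pos_right hcos).1 (e5 ▸ hcos')
    have hcos2 : Real.cos (θ' - ψ) = 1 := by
      rcases Real.sin_eq_zero_iff_cos_eq.1 hsin0 with h | h
      · exact h
      · linarith
    obtain ⟨k, hk⟩ := (Real.cos_eq_one_iff _).1 hcos2
    rw [hnorm, show θ' = ψ + k * (2 * Real.pi) by linarith]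
    exact hper.int_mul k ψ
  have hXτ : HasDerivAt (fun θ' => X (τ θ')) ((a * c + b * s) * ((b * c - a * s) / ρ θ)⁻¹) θ :=
    HasDerivAt.comp θ (h₂ := X) (by rw [hτθ]; exact hX.hasDerivAt) hτ.hasDerivAt
  have hYτ : HasDerivAt (fun θ' => Y (τ θ')) ((b * c - a * s) * ((b * c - a * s) / ρ θ)⁻¹) θ :=
    HasDerivAt.comp θ (h₂ := Y) (by rw [hτθ]; exact hY.hasDerivAt) hτ.hasDerivAt
  have hsq := ((hXτ.fun_pow 2).fun_add (hYτ.fun_pow 2)).sqrt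
    (by rw [hτθ, hX0, hY0]; positivity)
  refine (hsq.congr_of_eventuallyEq hev).congr_deriv ?_
  rw [hτθ, hX0, hY0, show ρ θ ^ 2 + (0 : ℝ) ^ 2 = ρ θ ^ 2 by ring, Real.sqrt_sq (hpos θ).le]
  simp only [inv_div]
  field_simp
  ring

/-! ### Grönwall estimates in a tube -/

/-- Grönwall's inequality when the differential inequality is known only inside a tube. -/
theorem abs_le_gronwallBound_of_tube {y y' : ℝ → ℝ} {T δ K η : ℝ} (hK : 0 ≤ K) (hη : 0 ≤ η)
    (hc : Continuous y)
    (hd : ∀ t ∈ Icc 0 T, |y t| < δ → HasDerivAt y (y' t) t ∧ |y' t| ≤ K * |y t| + η)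
    (hb : gronwallBound |y 0| K η T < δ) :
    ∀ t ∈ Icc 0 T, |y t| ≤ gronwallBound |y 0| K η T := by
  have hmono := gronwallBound_mono (abs_nonneg (y 0)) hη hK
  -- Only times strictly before `t` must lie in the tube, so the estimate still holds at the first
  -- exit time.
  have key : ∀ t ∈ Icc 0 T, (∀ s ∈ Ico 0 t, |y s| < δ) → |y t| ≤ gronwallBound |y 0| K η T := by
    intro t ht hs
    have h := norm_le_gronwallBound_of_norm_deriv_right_le (f := y) (f' := y') (δ := |y 0|)
      (K := K) (ε := η) (a := 0) (b := t) hc.continuousOn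
      (fun x hx => (hd x ⟨hx.1, hx.2.le.trans ht.2⟩ (hs x hx)).1.hasDerivWithinAt) le_rfl
      (fun x hx => (hd x ⟨hx.1, hx.2.le.trans ht.2⟩ (hs x hx)).2) t ⟨ht.1, le_rfl⟩
    exact h.trans (hmono (by linarith [ht.2]))
  have htube : ∀ t ∈ Icc 0 T, |y t| < δ := by
    by_contra! hcon
    obtain ⟨t, ht, hyt⟩ := hcon
    -- `sInf S` is the first exit time; there `key` gives a bound below `δ`, a contradiction.
    let S : Set ℝ := Icc 0 T ∩ {t | δ ≤ |y t|}
    have hS : IsClosed S := isClosed_Icc.inter (isClosed_le continuous_const hc.abs)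
    have hbdd : BddBelow S := ⟨0, fun x hx => hx.1.1⟩
    have hmem : sInf S ∈ S := hS.csInf_mem ⟨t, ht, hyt⟩ hbdd
    have := key _ hmem.1 fun s hs => by
      by_contra! hcon
      exact absurd (csInf_le hbdd ⟨⟨hs.1, hs.2.le.trans hmem.1.2⟩, hcon⟩) (not_le.2 hs.2)
    exact absurd (this.trans_lt hb) (not_lt.2 hmem.2)
  exact fun t ht => key t ht fun s hs => htube s ⟨hs.1, hs.2.le.trans ht.2⟩

theorem tendsto_gronwallBound_zero {K : ℝ} (hK : K ≠ 0) (T : ℝ) {ι : Type*} {l : Filter ι}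
    {x e : ι → ℝ} (hx : Tendsto x l (𝓝 0)) (he : Tendsto e l (𝓝 0)) :
    Tendsto (fun i => gronwallBound (x i) K (e i) T) l (𝓝 0) := by
  simp only [gronwallBound_of_K_ne_0 hK]
  simpa using (hx.mul_const (Real.exp (K * T))).add
    ((he.div_const K).mul_const (Real.exp (K * T) - 1))

/-- A family of continuous periodic functions that satisfies, in a fixed tube around the zero
function, a linear differential inequality with a small inhomogeneity, converges uniformly to zero
if its initial values do. -/
theorem eventually_forall_abs_lt {y y' : ℝ → ℝ → ℝ} {P δ K M : ℝ} (hP : 0 < P) (hδ : 0 < δ)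
    (hK : 0 < K) (hM : 0 ≤ M)
    (hc : ∀ᶠ ε in 𝓝[>] (0 : ℝ), Continuous (y ε))
    (hper : ∀ᶠ ε in 𝓝[>] (0 : ℝ), Function.Periodic (y ε) P)
    (hd : ∀ᶠ ε in 𝓝[>] (0 : ℝ), ∀ t, |y ε t| < δ →
      HasDerivAt (y ε) (y' ε t) t ∧ |y' ε t| ≤ K * |y ε t| + ε * M)
    (h0 : Tendsto (fun ε => y ε 0) (𝓝[>] 0) (𝓝 0)) {η : ℝ} (hη : 0 < η) :
    ∀ᶠ ε in 𝓝[>] (0 : ℝ), ∀ t, |y ε t| < η := by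
  have hε : Tendsto (fun ε : ℝ => ε * M) (𝓝[>] 0) (𝓝 0) := by
    simpa using ((tendsto_id (x := 𝓝 (0 : ℝ))).mono_left nhdsWithin_le_nhds).mul_const M
  -- The Grönwall bound over one period tends to zero. Below `δ` it confines the solution to the
  -- tube, below `η` it gives the claim, and periodicity covers all `t`.
  have hg := tendsto_gronwallBound_zero hK.ne' P (by simpa using h0.abs) hε
  filter_upwards [hc, hper, hd, hg.eventually_lt_const (lt_min hδ hη), self_mem_nhdsWithin]
    with ε hc hper hd hg hpos t
  obtain ⟨s, hs, hst⟩ := hper.exists_mem_Ico₀ hP t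
  rw [hst]
  exact (abs_le_gronwallBound_of_tube hK.le (mul_nonneg (le_of_lt hpos) hM) hc
    (fun t _ => hd t) (hg.trans_le (min_le_left _ _)) s ⟨hs.1, hs.2.le⟩).trans_lt
    (hg.trans_le (min_le_right _ _))

/-! ### Linear equations with zero boundary values -/

/-- If `z' = a z + ε b` on an interval at whose ends `z` vanishes, then `b` is orthogonal to the
integrating factor. -/
theorem integral_mul_exp_eq_zero {z a b : ℝ → ℝ} {α β ε : ℝ} (hε : ε ≠ 0) (ha : Continuous a)
    (hb : Continuous b) (hz : ∀ t, HasDerivAt z (a t * z t + ε * b t) t) (hα : z α = 0)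
    (hβ : z β = 0) :
    ∫ t in α..β, b t * Real.exp (-∫ s in (0 : ℝ)..t, a s) = 0 := by
  have hI : ∀ t, HasDerivAt (fun t => ∫ s in (0 : ℝ)..t, a s) (a t) t := fun t =>
    intervalIntegral.integral_hasDerivAt_right (ha.intervalIntegrable _ _)
      ha.aestronglyMeasurable.stronglyMeasurableAtFilter ha.continuousAt
  have hIc : Continuous fun t => ∫ s in (0 : ℝ)..t, a s :=
    continuous_iff_continuousAt.2 fun t => (hI t).continuousAt
  have hder : ∀ t, HasDerivAt (fun t => z t * Real.exp (-∫ s in (0 : ℝ)..t, a s))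
      (ε * (b t * Real.exp (-∫ s in (0 : ℝ)..t, a s))) t := fun t =>
    ((hz t).fun_mul (hI t).fun_neg.exp).congr_deriv (by ring)
  have hint := intervalIntegral.integral_eq_sub_of_hasDerivAt (a := α) (b := β)
    (fun t _ => hder t)
    ((by fun_prop : Continuous fun t => ε * (b t * Real.exp (-∫ s in (0 : ℝ)..t, a s))
      ).intervalIntegrable _ _)
  rw [hα, hβ, intervalIntegral.integral_const_mul] at hint
  simpa [hε] using hint

/-- The limit of `integral_mul_exp_eq_zero` as `ε → 0`. -/
theorem integral_mul_exp_eq_zero_of_tendsto {z a b : ℝ → ℝ → ℝ} {a₀ b₀ : ℝ → ℝ} {α β Ka Kb : ℝ}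
    (ha : ∀ᶠ ε in 𝓝[>] (0 : ℝ), Continuous (a ε)) (hb : ∀ᶠ ε in 𝓝[>] (0 : ℝ), Continuous (b ε))
    (hz : ∀ᶠ ε in 𝓝[>] (0 : ℝ), ∀ t, HasDerivAt (z ε) (a ε t * z ε t + ε * b ε t) t)
    (hα : ∀ᶠ ε in 𝓝[>] (0 : ℝ), z ε α = 0) (hβ : ∀ᶠ ε in 𝓝[>] (0 : ℝ), z ε β = 0)
    (hKa : ∀ᶠ ε in 𝓝[>] (0 : ℝ), ∀ t, |a ε t| ≤ Ka)
    (hKb : ∀ᶠ ε in 𝓝[>] (0 : ℝ), ∀ t, |b ε t| ≤ Kb)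
    (ha₀ : ∀ t, Tendsto (fun ε => a ε t) (𝓝[>] 0) (𝓝 (a₀ t)))
    (hb₀ : ∀ t, Tendsto (fun ε => b ε t) (𝓝[>] 0) (𝓝 (b₀ t))) :
    ∫ t in α..β, b₀ t * Real.exp (-∫ s in (0 : ℝ)..t, a₀ s) = 0 := by
  have hI : ∀ t, Tendsto (fun ε => ∫ s in (0 : ℝ)..t, a ε s) (𝓝[>] 0)
      (𝓝 (∫ s in (0 : ℝ)..t, a₀ s)) := fun t =>
    intervalIntegral.tendsto_integral_filter_of_dominated_convergence (fun _ => Ka)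
      (ha.mono fun ε h => h.aestronglyMeasurable)
      (hKa.mono fun ε h => Eventually.of_forall fun t _ => h t) intervalIntegrable_const
      (Eventually.of_forall fun t _ => ha₀ t)
  have hlim : Tendsto (fun ε => ∫ t in α..β, b ε t * Real.exp (-∫ s in (0 : ℝ)..t, a ε s))
      (𝓝[>] 0) (𝓝 (∫ t in α..β, b₀ t * Real.exp (-∫ s in (0 : ℝ)..t, a₀ s))) := by
    refine intervalIntegral.tendsto_integral_filter_of_dominated_convergence
      -- The exponent is at most `Ka * |t|` in absolute value because `|a| ≤ Ka`.
      (fun t => Kb * Real.exp (Ka * |t|)) ?_ ?_ ?_ ?_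
    · filter_upwards [ha, hb] with ε ha hb
      have hIc : Continuous fun t => ∫ s in (0 : ℝ)..t, a ε s :=
        intervalIntegral.continuous_primitive (fun _ _ => ha.intervalIntegrable _ _) 0
      exact (by fun_prop : Continuous fun t =>
        b ε t * Real.exp (-∫ s in (0 : ℝ)..t, a ε s)).aestronglyMeasurable
    · filter_upwards [hKa, hKb] with ε hKa hKb
      refine Eventually.of_forall fun t _ => ?_
      rw [norm_mul, Real.norm_eq_abs, Real.norm_eq_abs, Real.abs_exp]
      refine mul_le_mul (hKb t) (Real.exp_le_exp.2 ?_) (Real.exp_pos _).le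
        ((abs_nonneg _).trans (hKb t))
      have := intervalIntegral.norm_integral_le_of_norm_le_const (a := 0) (b := t) (f := a ε)
        fun s _ => hKa s
      rw [sub_zero] at this
      exact (neg_le_abs _).trans this
    · exact (by fun_prop : Continuous fun t : ℝ => Kb * Real.exp (Ka * |t|)).intervalIntegrable _ _
    · exact Eventually.of_forall fun t _ =>
        (hb₀ t).mul ((Real.continuous_exp.tendsto _).comp (hI t).neg)
  refine tendsto_nhds_unique hlim (Tendsto.congr' ?_ tendsto_const_nhds)
  filter_upwards [ha, hb, hz, hα, hβ, self_mem_nhdsWithin] with ε ha hb hz hα hβ hε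
  exact (integral_mul_exp_eq_zero (ne_of_gt hε) ha hb hz hα hβ).symm

/-! ### Polynomials along rays and their divided differences -/

theorem continuous_eval_pair {X : Type*} [TopologicalSpace X] (H : MvPolynomial (Fin 2) ℝ)
    {g h : X → ℝ} (hg : Continuous g) (hh : Continuous h) :
    Continuous fun x => MvPolynomial.eval ![g x, h x] H := by
  refine (MvPolynomial.continuous_eval H).comp (continuous_pi fun i => ?_)
  fin_cases i <;> simpa

theorem continuous_eval_triple {X : Type*} [TopologicalSpace X] (H : MvPolynomial (Fin 3) ℝ)
    {g h k : X → ℝ} (hg : Continuous g) (hh : Continuous h) (hk : Continuous k) :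
    Continuous fun x => MvPolynomial.eval ![g x, h x, k x] H := by
  refine (MvPolynomial.continuous_eval H).comp (continuous_pi fun i => ?_)
  fin_cases i <;> simpa

/-- The value of `H` at the point with polar radius `r` and direction `(v, u)`. -/
noncomputable def ray (H : MvPolynomial (Fin 2) ℝ) (r u v : ℝ) : ℝ :=
  MvPolynomial.eval ![r * v, r * u] H

@[fun_prop]
theorem continuous_ray {X : Type*} [TopologicalSpace X] (H : MvPolynomial (Fin 2) ℝ)
    {r u v : X → ℝ} (hr : Continuous r) (hu : Continuous u) (hv : Continuous v) :
    Continuous fun x => ray H (r x) (u x) (v x) :=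
  continuous_eval_pair H (hr.mul hv) (hr.mul hu)

theorem eval_sqSubst (K : MvPolynomial (Fin 2) ℝ) (x y : ℝ) :
    MvPolynomial.eval ![x, y] (sqSubst K) = MvPolynomial.eval ![x ^ 2, y] K := by
  induction K using MvPolynomial.induction_on with
  | C a => simp [sqSubst]
  | add p q hp hq =>
    simp only [sqSubst, map_add] at *
    rw [hp, hq]
  | mul_X p i hp =>
    simp only [sqSubst, map_mul] at *
    rw [hp]
    fin_cases i <;> simp

theorem ray_sqSubst (K : MvPolynomial (Fin 2) ℝ) (r u v : ℝ) :
    ray (sqSubst K) r u v = MvPolynomial.eval ![(r * v) ^ 2, r * u] K :=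
  eval_sqSubst K _ _

/-- This is the reversibility: `v ↦ -v` is the reflection `x ↦ -x`, which fixes `x²`. -/
theorem ray_sqSubst_neg (K : MvPolynomial (Fin 2) ℝ) (r u v : ℝ) :
    ray (sqSubst K) r u (-v) = ray (sqSubst K) r u v := by
  rw [ray_sqSubst, ray_sqSubst, mul_neg, neg_sq]

theorem ray_sqSubst_eq_K00 (K : MvPolynomial (Fin 2) ℝ) {r u v : ℝ} (hv : v ^ 2 = 1 - u ^ 2) :
    ray (sqSubst K) r u v = K00 K r u := by
  rw [ray_sqSubst, K00, mul_pow, hv, mul_comm (r ^ 2), mul_comm r u]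

theorem ray_eq_part0_add (H : MvPolynomial (Fin 2) ℝ) {r u v : ℝ} (hv : v ^ 2 = 1 - u ^ 2) :
    ray H r u v = MvPolynomial.eval ![r, 0, u] (part0 H) +
      v * MvPolynomial.eval ![r, 0, u] (part1 H) := by
  simpa [ray] using eval_decomposition H r 0 u v hv

/-- Divided differences of a polynomial along rays are continuous. -/
theorem exists_dividedDifference (H : MvPolynomial (Fin 2) ℝ) :
    ∃ q : ℝ × ℝ × ℝ × ℝ → ℝ, Continuous q ∧
      ∀ r s u v, ray H r u v - ray H s u v = (r - s) * q (r, s, u, v) := by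
  induction H using MvPolynomial.induction_on with
  | C a => exact ⟨0, continuous_const, by simp [ray]⟩
  | add p q hp hq =>
    obtain ⟨P, hPc, hP⟩ := hp
    obtain ⟨Q, hQc, hQ⟩ := hq
    refine ⟨fun x => P x + Q x, hPc.add hQc, fun r s u v => ?_⟩
    simp only [ray, map_add] at *
    linear_combination hP r s u v + hQ r s u v
  | mul_X p i hp =>
    obtain ⟨P, hPc, hP⟩ := hp
    let w : ℝ × ℝ × ℝ × ℝ → ℝ := fun x => ![x.2.2.2, x.2.2.1] i
    have hw : Continuous w := by
      fin_cases i
      · exact (by fun_prop : Continuous fun x : ℝ × ℝ × ℝ × ℝ => x.2.2.2)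
      · exact (by fun_prop : Continuous fun x : ℝ × ℝ × ℝ × ℝ => x.2.2.1)
    have hi : ∀ r s u v, ray (MvPolynomial.X i) r u v = r * w (r, s, u, v) ∧
        ray (MvPolynomial.X i) s u v = s * w (r, s, u, v) := by
      intro r s u v
      fin_cases i <;> simp [ray, w]
    -- Product rule for differences: `r p(r) - s p(s) = r (p(r) - p(s)) + (r - s) p(s)`, multiplied
    -- by the direction `w`.
    refine ⟨fun x => P x * (x.1 * w x) + ray p x.2.1 x.2.2.1 x.2.2.2 * w x, by fun_prop,
      fun r s u v => ?_⟩
    have hmul : ∀ t, ray (p * MvPolynomial.X i) t u v = ray p t u v * ray (MvPolynomial.X i) t u v :=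
      fun t => by simp only [ray, map_mul]
    rw [hmul, hmul, (hi r s u v).1, (hi r s u v).2]
    linear_combination (r * w (r, s, u, v)) * hP r s u v

/-- `K₁₀(f, 0, u)` is the radial derivative of `K(x², y)`. -/
theorem dividedDifference_self_eq_K10 {K : MvPolynomial (Fin 2) ℝ} {q : ℝ × ℝ × ℝ × ℝ → ℝ}
    (hq : Continuous q)
    (h : ∀ r s u v, ray (sqSubst K) r u v - ray (sqSubst K) s u v = (r - s) * q (r, s, u, v))
    {r u v : ℝ} (hv : v ^ 2 = 1 - u ^ 2) (hv0 : v ≠ 0) :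
    q (r, r, u, v) = MvPolynomial.eval ![r, 0, u] (K10 K) := by
  -- At radius `r - v g` the direction `v` may be replaced by `-v`, so the decomposition gives `H₀ ±
  -- v g K₁₀` at the radii `r ± v g`. The difference is `2 v g K₁₀`, and `2 v g` cancels because `v`
  -- and `g` are nonzero; then `g → 0`.
  have key : ∀ g : ℝ, g ≠ 0 →
      q (r + v * g, r - v * g, u, v) = MvPolynomial.eval ![r, g, u] (K10 K) := by
    intro g hg
    have h1 := eval_decomposition (sqSubst K) r g u v hv
    have h2 := eval_decomposition (sqSubst K) r g u (-v) (by rw [neg_sq, hv])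
    rw [← X_mul_K10, map_mul, MvPolynomial.eval_X] at h1 h2
    have h3 := h (r + v * g) (r - v * g) u v
    have h4 : ray (sqSubst K) (r - v * g) u v =
        MvPolynomial.eval ![(r + -v * g) * -v, (r + -v * g) * u] (sqSubst K) := by
      rw [← ray_sqSubst_neg, ray]
      simp only [neg_mul, sub_eq_add_neg]
    rw [h4, ray, h1, h2] at h3
    have h5 : (2 * v * g) * q (r + v * g, r - v * g, u, v) =
        (2 * v * g) * MvPolynomial.eval ![r, g, u] (K10 K) := by
      simp only [Matrix.cons_val_one, Matrix.cons_val_zero] at h3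
      linear_combination -h3
    exact mul_left_cancel₀ (by positivity) h5
  have c1 : Continuous fun g : ℝ => q (r + v * g, r - v * g, u, v) := by fun_prop
  have c2 : Continuous fun g : ℝ => MvPolynomial.eval ![r, g, u] (K10 K) :=
    continuous_eval_triple _ continuous_const continuous_id continuous_const
  have h0 : Tendsto (fun g : ℝ => q (r + v * g, r - v * g, u, v)) (𝓝[≠] 0) (𝓝 (q (r, r, u, v))) := by
    simpa using (c1.tendsto 0).mono_left nhdsWithin_le_nhds
  refine tendsto_nhds_unique h0 (((c2.tendsto 0).mono_left nhdsWithin_le_nhds).congr' ?_)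
  filter_upwards [self_mem_nhdsWithin] with g hg
  exact (key g hg).symm

/-! ### The perturbed equation in polar coordinates -/

/-- The numerator of `dr/du` for the unperturbed system. -/
noncomputable def polarNum (A B : MvPolynomial (Fin 2) ℝ) (r u v : ℝ) : ℝ :=
  (ray (sqSubst A) r u v + u * ray (sqSubst B) r u v * r) * r

/-- The denominator of `dr/du` for the unperturbed system. -/
noncomputable def polarDen (A B : MvPolynomial (Fin 2) ℝ) (r u v : ℝ) : ℝ :=
  v ^ 2 * ray (sqSubst B) r u v * r - u * ray (sqSubst A) r u v

/-- The angular component of the perturbation. -/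
noncomputable def angPert (C D : MvPolynomial (Fin 2) ℝ) (r u v : ℝ) : ℝ :=
  v * ray D r u v - u * ray C r u v

/-- The quotient by `ε` of the difference of `dr/dθ` for the perturbed and the unperturbed
system. -/
noncomputable def polarPert (A B C D : MvPolynomial (Fin 2) ℝ) (ε r u v : ℝ) : ℝ :=
  r * (r * v * ray (sqSubst B) r u v * ray C r u v - ray (sqSubst A) r u v * ray D r u v) /
    (polarDen A B r u v * (polarDen A B r u v + ε * angPert C D r u v))

@[fun_prop]
theorem continuous_polarDen {X : Type*} [TopologicalSpace X] (A B : MvPolynomial (Fin 2) ℝ)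
    {r u v : X → ℝ} (hr : Continuous r) (hu : Continuous u) (hv : Continuous v) :
    Continuous fun x => polarDen A B (r x) (u x) (v x) := by
  unfold polarDen; fun_prop

@[fun_prop]
theorem continuous_angPert {X : Type*} [TopologicalSpace X] (C D : MvPolynomial (Fin 2) ℝ)
    {r u v : X → ℝ} (hr : Continuous r) (hu : Continuous u) (hv : Continuous v) :
    Continuous fun x => angPert C D (r x) (u x) (v x) := by
  unfold angPert; fun_prop

theorem polarDen_neg (A B : MvPolynomial (Fin 2) ℝ) (r u v : ℝ) :
    polarDen A B r u (-v) = polarDen A B r u v := by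
  simp only [polarDen, ray_sqSubst_neg, neg_sq]

theorem polarNum_neg (A B : MvPolynomial (Fin 2) ℝ) (r u v : ℝ) :
    polarNum A B r u (-v) = polarNum A B r u v := by
  simp only [polarNum, ray_sqSubst_neg]

/-- Continuity of `polarPert` where its denominators do not vanish. -/
theorem continuousOn_polarPert {X : Type*} [TopologicalSpace X] (A B C D : MvPolynomial (Fin 2) ℝ)
    {s : Set X} {ε r u v : X → ℝ} (hε : Continuous ε) (hr : Continuous r) (hu : Continuous u)
    (hv : Continuous v) (h1 : ∀ x ∈ s, polarDen A B (r x) (u x) (v x) ≠ 0)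
    (h2 : ∀ x ∈ s, polarDen A B (r x) (u x) (v x) + ε x * angPert C D (r x) (u x) (v x) ≠ 0) :
    ContinuousOn (fun x => polarPert A B C D (ε x) (r x) (u x) (v x)) s := by
  unfold polarPert
  refine ContinuousOn.div (Continuous.continuousOn (by fun_prop))
    (Continuous.continuousOn (by fun_prop)) fun x hx => mul_ne_zero (h1 x hx) (h2 x hx)

/-- At `ε = 0` the denominator is even in `v`, so the sum extracts the even part of the numerator.
With `C = C₀ + v C₁` and `D = D₀ + v D₁`, only `v² C₁` and `D₀` survive. -/
theorem polarPert_zero_add_neg (A B C D : MvPolynomial (Fin 2) ℝ) {r u v : ℝ}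
    (hv : v ^ 2 = 1 - u ^ 2) :
    polarPert A B C D 0 r u v + polarPert A B C D 0 r u (-v) =
      2 * (-r * (K00 A r u * MvPolynomial.eval ![r, 0, u] (part0 D) -
        (1 - u ^ 2) * K00 B r u * MvPolynomial.eval ![r, 0, u] (part1 C) * r) /
        (u * K00 A r u - (1 - u ^ 2) * K00 B r u * r) ^ 2) := by
  have hv' : (-v) ^ 2 = 1 - u ^ 2 := by rw [neg_sq, hv]
  simp only [polarPert, polarDen_neg, ray_sqSubst_neg, zero_mul, add_zero]
  rw [ray_eq_part0_add C hv, ray_eq_part0_add D hv, ray_eq_part0_add C hv',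
    ray_eq_part0_add D hv', polarDen, ray_sqSubst_eq_K00 A hv, ray_sqSubst_eq_K00 B hv,
    ← add_div, ← mul_div_assoc, ← hv]
  congr 1 <;> ring

/-- The equation of the trajectories of the perturbed system in polar coordinates. -/
theorem field_polar (A B C D : MvPolynomial (Fin 2) ℝ) {ε r u v : ℝ} (hv : v ^ 2 = 1 - u ^ 2) :
    (field A B C D ε (r * v, r * u)).2 * v - (field A B C D ε (r * v, r * u)).1 * u =
      polarDen A B r u v + ε * angPert C D r u v ∧
    (polarDen A B r u v ≠ 0 → polarDen A B r u v + ε * angPert C D r u v ≠ 0 →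
      r * ((field A B C D ε (r * v, r * u)).1 * v + (field A B C D ε (r * v, r * u)).2 * u) /
        ((field A B C D ε (r * v, r * u)).2 * v - (field A B C D ε (r * v, r * u)).1 * u) =
      v * (polarNum A B r u v / polarDen A B r u v) + ε * polarPert A B C D ε r u v) := by
  have h1 : (field A B C D ε (r * v, r * u)).1 = ray (sqSubst A) r u v + ε * ray C r u v := by
    rw [ray_sqSubst]; rfl
  have h2 : (field A B C D ε (r * v, r * u)).2 =
      r * v * ray (sqSubst B) r u v + ε * ray D r u v := by
    rw [ray_sqSubst]; rfl
  have h3 : (field A B C D ε (r * v, r * u)).2 * v - (field A B C D ε (r * v, r * u)).1 * u =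
      polarDen A B r u v + ε * angPert C D r u v := by
    rw [h1, h2, polarDen, angPert]; ring
  refine ⟨h3, fun hd he => ?_⟩
  rw [h3, h1, h2, polarPert, ← mul_div_assoc, ← mul_div_assoc, div_add_div _ _ hd
    (mul_ne_zero hd he), div_eq_div_iff he (mul_ne_zero hd (mul_ne_zero hd he))]
  simp only [polarNum]
  set d := polarDen A B r u v with hd'
  set e := d + ε * angPert C D r u v with he'
  -- After cross-multiplication the difference of the two quotients leaves, by `u² + v² = 1`, only
  -- `ε` times the cross product of the unperturbed field and the perturbation.
  have key : r * ((ray (sqSubst A) r u v + ε * ray C r u v) * v +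
      (r * v * ray (sqSubst B) r u v + ε * ray D r u v) * u) * d =
      v * ((ray (sqSubst A) r u v + u * ray (sqSubst B) r u v * r) * r) * e +
      ε * (r * (r * v * ray (sqSubst B) r u v * ray C r u v -
        ray (sqSubst A) r u v * ray D r u v)) := by
    rw [he', hd', polarDen, angPert]
    linear_combination ε * (r * (r * v * ray (sqSubst B) r u v * ray C r u v -
      ray (sqSubst A) r u v * ray D r u v)) * hv
  linear_combination d * e * key

/-- The divided difference of the unperturbed `dr/du`. -/
theorem exists_slope (A B : MvPolynomial (Fin 2) ℝ) :
    ∃ w : ℝ × ℝ × ℝ × ℝ → ℝ, Continuous w ∧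
      (∀ r s u v, polarDen A B r u v ≠ 0 → polarDen A B s u v ≠ 0 →
        polarNum A B r u v / polarDen A B r u v - polarNum A B s u v / polarDen A B s u v =
          w (r, s, u, v) / (polarDen A B r u v * polarDen A B s u v) * (r - s)) ∧
      ∀ r u v, v ^ 2 = 1 - u ^ 2 → v ≠ 0 → w (r, r, u, v) =
        r ^ 2 * (MvPolynomial.eval ![r, 0, u] (K10 A) * K00 B r u -
          K00 A r u * MvPolynomial.eval ![r, 0, u] (K10 B)) - u * K00 A r u ^ 2 +
          u * (1 - u ^ 2) * r ^ 2 * K00 B r u ^ 2 - 2 * u ^ 2 * r * K00 A r u * K00 B r u := by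
  obtain ⟨P, hPc, hP⟩ := exists_dividedDifference (sqSubst A)
  obtain ⟨Q, hQc, hQ⟩ := exists_dividedDifference (sqSubst B)
  -- `n` and `d` are divided differences of `polarNum` and `polarDen`; the witness `w` is the
  -- numerator in the quotient rule for differences.
  let n : ℝ × ℝ × ℝ × ℝ → ℝ := fun x => P x * x.1 + ray (sqSubst A) x.2.1 x.2.2.1 x.2.2.2 +
    x.2.2.1 * (x.1 ^ 2 * Q x + ray (sqSubst B) x.2.1 x.2.2.1 x.2.2.2 * (x.1 + x.2.1))
  let d : ℝ × ℝ × ℝ × ℝ → ℝ := fun x =>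
    x.2.2.2 ^ 2 * (Q x * x.1 + ray (sqSubst B) x.2.1 x.2.2.1 x.2.2.2) - x.2.2.1 * P x
  refine ⟨fun x => n x * polarDen A B x.2.1 x.2.2.1 x.2.2.2 -
    polarNum A B x.2.1 x.2.2.1 x.2.2.2 * d x, ?_, fun r s u v hr hs => ?_, fun r u v hv hv0 => ?_⟩
  · unfold polarNum
    fun_prop
  · have hn : polarNum A B r u v - polarNum A B s u v = n (r, s, u, v) * (r - s) := by
      simp only [polarNum, n]
      linear_combination r * hP r s u v + u * r ^ 2 * hQ r s u v
    have hd : polarDen A B r u v - polarDen A B s u v = d (r, s, u, v) * (r - s) := by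
      simp only [polarDen, d]
      linear_combination v ^ 2 * r * hQ r s u v - u * hP r s u v
    field_simp
    linear_combination polarDen A B s u v * hn - polarNum A B s u v * hd
  · simp only [n, d, polarNum, polarDen, dividedDifference_self_eq_K10 hPc hP hv hv0,
      dividedDifference_self_eq_K10 hQc hQ hv hv0, ray_sqSubst_eq_K00 A hv,
      ray_sqSubst_eq_K00 B hv, hv]
    ring

/-! ### Convergence of the integrals and the substitution `u = sin θ` -/

section

/-- The derivative with respect to `r`, along the unperturbed solution `f`, of `dr/du` for the
unperturbed system. -/
noncomputable def radialDeriv (A B : MvPolynomial (Fin 2) ℝ) (f : ℝ → ℝ) (u : ℝ) : ℝ :=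
  (f u ^ 2 * (MvPolynomial.eval ![f u, 0, u] (K10 A) * K00 B (f u) u -
      K00 A (f u) u * MvPolynomial.eval ![f u, 0, u] (K10 B)) - u * K00 A (f u) u ^ 2 +
    u * (1 - u ^ 2) * f u ^ 2 * K00 B (f u) u ^ 2 -
    2 * u ^ 2 * f u * K00 A (f u) u * K00 B (f u) u) /
  (u * K00 A (f u) u - (1 - u ^ 2) * K00 B (f u) u * f u) ^ 2

/-- The product `(1 - u²) M(u)`. -/
noncomputable def pertEven (A B C D : MvPolynomial (Fin 2) ℝ) (f : ℝ → ℝ) (u : ℝ) : ℝ :=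
  -f u * (K00 A (f u) u * MvPolynomial.eval ![f u, 0, u] (part0 D) -
    (1 - u ^ 2) * K00 B (f u) u * MvPolynomial.eval ![f u, 0, u] (part1 C) * f u) /
  (u * K00 A (f u) u - (1 - u ^ 2) * K00 B (f u) u * f u) ^ 2

theorem continuousOn_K00_comp (K : MvPolynomial (Fin 2) ℝ) {f : ℝ → ℝ} {s : Set ℝ}
    (hf : ContinuousOn f s) : ContinuousOn (fun u => K00 K (f u) u) s := by
  have h : Continuous fun p : ℝ × ℝ => K00 K p.1 p.2 :=
    continuous_eval_pair K (by fun_prop) (by fun_prop)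
  simpa only [Function.comp_def] using h.comp_continuousOn (hf.prodMk (continuousOn_id' s))

theorem continuousOn_eval_comp (K : MvPolynomial (Fin 3) ℝ) {f : ℝ → ℝ} {s : Set ℝ}
    (hf : ContinuousOn f s) : ContinuousOn (fun u => MvPolynomial.eval ![f u, 0, u] K) s := by
  have h : Continuous fun p : ℝ × ℝ => MvPolynomial.eval ![p.1, 0, p.2] K :=
    continuous_eval_triple K (by fun_prop) (by fun_prop) (by fun_prop)
  simpa only [Function.comp_def] using h.comp_continuousOn (hf.prodMk (continuousOn_id' s))

variable {A B C D : MvPolynomial (Fin 2) ℝ} {f : ℝ → ℝ}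

theorem continuousOn_radialDeriv (hf : ContinuousOn f (Icc (-1) 1))
    (hd : ∀ u ∈ Icc (-1 : ℝ) 1, u * K00 A (f u) u - (1 - u ^ 2) * K00 B (f u) u * f u ≠ 0) :
    ContinuousOn (radialDeriv A B f) (Icc (-1) 1) := by
  have aux : ∀ {a b c d : ℝ → ℝ}, ContinuousOn a (Icc (-1) 1) → ContinuousOn b (Icc (-1) 1) →
      ContinuousOn c (Icc (-1) 1) → ContinuousOn d (Icc (-1) 1) →
      (∀ u ∈ Icc (-1 : ℝ) 1, u * a u - (1 - u ^ 2) * b u * f u ≠ 0) →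
      ContinuousOn (fun u => (f u ^ 2 * (c u * b u - a u * d u) - u * a u ^ 2 +
        u * (1 - u ^ 2) * f u ^ 2 * b u ^ 2 - 2 * u ^ 2 * f u * a u * b u) /
        (u * a u - (1 - u ^ 2) * b u * f u) ^ 2) (Icc (-1) 1) := fun ha hb hc hd h =>
    ContinuousOn.div (by fun_prop) (by fun_prop) fun u hu => pow_ne_zero 2 (h u hu)
  exact aux (continuousOn_K00_comp A hf) (continuousOn_K00_comp B hf)
    (continuousOn_eval_comp (K10 A) hf) (continuousOn_eval_comp (K10 B) hf) hd

theorem continuousOn_pertEven (hf : ContinuousOn f (Icc (-1) 1))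
    (hd : ∀ u ∈ Icc (-1 : ℝ) 1, u * K00 A (f u) u - (1 - u ^ 2) * K00 B (f u) u * f u ≠ 0) :
    ContinuousOn (pertEven A B C D f) (Icc (-1) 1) := by
  have aux : ∀ {a b c d : ℝ → ℝ}, ContinuousOn a (Icc (-1) 1) → ContinuousOn b (Icc (-1) 1) →
      ContinuousOn c (Icc (-1) 1) → ContinuousOn d (Icc (-1) 1) →
      (∀ u ∈ Icc (-1 : ℝ) 1, u * a u - (1 - u ^ 2) * b u * f u ≠ 0) →
      ContinuousOn (fun u => -f u * (a u * d u - (1 - u ^ 2) * b u * c u * f u) /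
        (u * a u - (1 - u ^ 2) * b u * f u) ^ 2) (Icc (-1) 1) := fun ha hb hc hd h =>
    ContinuousOn.div (by fun_prop) (by fun_prop) fun u hu => pow_ne_zero 2 (h u hu)
  exact aux (continuousOn_K00_comp A hf) (continuousOn_K00_comp B hf)
    (continuousOn_eval_comp (part1 C) hf) (continuousOn_eval_comp (part0 D) hf) hd

theorem one_sub_sq_pos {u : ℝ} (hu : u ∈ Ioo (-1 : ℝ) 1) : 0 < 1 - u ^ 2 := by
  nlinarith [hu.1, hu.2]

/-- For a deviation `v g` from `f`, `radialDeriv` is the linear coefficient for `v g` and `L` the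
one for `g`. They differ by `-v'/v = u / (1 - u²)`, where `v = √(1 - u²)`. -/
theorem Lfun_eq {u : ℝ} (hu : u ∈ Ioo (-1 : ℝ) 1)
    (hd : u * K00 A (f u) u - (1 - u ^ 2) * K00 B (f u) u * f u ≠ 0) :
    Lfun A B f u = radialDeriv A B f u + u / (1 - u ^ 2) := by
  have := (one_sub_sq_pos hu).ne'
  rw [Lfun, radialDeriv, Sfun]
  rw [div_add_div _ _ (pow_ne_zero 2 hd) this, div_eq_div_iff (mul_ne_zero this (pow_ne_zero 2 hd))
    (mul_ne_zero (pow_ne_zero 2 hd) this)]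
  ring

/-- The singular term has primitive `-log (1 - u²) / 2`, so it contributes exactly the factor `√(1 -
u²)` to `exp (-∫ L)`. -/
theorem intervalIntegrable_Lfun (hf : ContinuousOn f (Icc (-1) 1))
    (hd : ∀ u ∈ Icc (-1 : ℝ) 1, u * K00 A (f u) u - (1 - u ^ 2) * K00 B (f u) u * f u ≠ 0)
    {u : ℝ} (hu : u ∈ Ioo (-1 : ℝ) 1) :
    IntervalIntegrable (Lfun A B f) volume 0 u ∧
      ∫ s in (0 : ℝ)..u, Lfun A B f s =
        (∫ s in (0 : ℝ)..u, radialDeriv A B f s) - Real.log (1 - u ^ 2) / 2 := by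
  have hsub : uIcc 0 u ⊆ Ioo (-1 : ℝ) 1 := ordConnected_Ioo.uIcc_subset (by norm_num) hu
  have h1 : IntervalIntegrable (radialDeriv A B f) volume 0 u :=
    ((continuousOn_radialDeriv hf hd).mono (hsub.trans Ioo_subset_Icc_self)).intervalIntegrable
  have h2 : IntervalIntegrable (fun u : ℝ => u / (1 - u ^ 2)) volume 0 u :=
    ContinuousOn.intervalIntegrable (continuousOn_id.div (by fun_prop)
      fun s hs => (one_sub_sq_pos (hsub hs)).ne')
  have heq : EqOn (Lfun A B f) (fun s => radialDeriv A B f s + s / (1 - s ^ 2)) (uIcc 0 u) :=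
    fun s hs => Lfun_eq (hsub hs) (hd s (Ioo_subset_Icc_self (hsub hs)))
  refine ⟨(h1.add h2).congr fun s hs => (heq (uIoc_subset_uIcc hs)).symm, ?_⟩
  rw [intervalIntegral.integral_congr heq, intervalIntegral.integral_add h1 h2]
  have h3 : ∫ s in (0 : ℝ)..u, s / (1 - s ^ 2) =
      -(Real.log (1 - u ^ 2) / 2) - -(Real.log (1 - 0 ^ 2) / 2) := by
    refine intervalIntegral.integral_eq_sub_of_hasDerivAt
      (f := fun s : ℝ => -(Real.log (1 - s ^ 2) / 2)) (fun s hs => ?_) h2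
    have hs' := (one_sub_sq_pos (hsub hs)).ne'
    refine (((((hasDerivAt_id s).fun_pow 2).const_sub 1).log hs').div_const 2).fun_neg.congr_deriv ?_
    simp only [id]
    field_simp
    ring
  rw [h3]
  simp
  ring

/-- The substitution `u = sin θ` in the integral that defines `N`. -/
theorem Nfun_eq (hf : ContinuousOn f (Icc (-1) 1))
    (hd : ∀ u ∈ Icc (-1 : ℝ) 1, u * K00 A (f u) u - (1 - u ^ 2) * K00 B (f u) u * f u ≠ 0) :
    IntervalIntegrable (integrand A B C D f) volume (-1) 1 ∧
      Nfun A B C D f = ∫ θ in (-(Real.pi / 2))..(Real.pi / 2), pertEven A B C D f (Real.sin θ) *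
        Real.exp (-∫ t in (0 : ℝ)..θ, Real.cos t * radialDeriv A B f (Real.sin t)) := by
  have hpi := Real.pi_pos
  have hH := continuousOn_radialDeriv hf hd
  have hsinIcc : ∀ θ, Real.sin θ ∈ Icc (-1 : ℝ) 1 := Real.sin_mem_Icc
  have hHs : Continuous fun t => Real.cos t * radialDeriv A B f (Real.sin t) :=
    Real.continuous_cos.mul (hH.comp_continuous Real.continuous_sin hsinIcc)
  have hPs : Continuous fun t => pertEven A B C D f (Real.sin t) :=
    (continuousOn_pertEven hf hd).comp_continuous Real.continuous_sin hsinIcc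
  have hexp : ∀ θ, ∫ t in (0 : ℝ)..θ, Real.cos t * radialDeriv A B f (Real.sin t) =
      ∫ s in (0 : ℝ)..Real.sin θ, radialDeriv A B f s := by
    intro θ
    have := intervalIntegral.integral_comp_mul_deriv'' (f := Real.sin) (f' := Real.cos)
      (g := radialDeriv A B f) (a := 0) (b := θ) Real.continuous_sin.continuousOn
      (fun x _ => (Real.hasDerivAt_sin x).hasDerivWithinAt) Real.continuous_cos.continuousOn
      (hH.mono (by rintro _ ⟨x, -, rfl⟩; exact hsinIcc x))
    rw [Real.sin_zero] at this
    rw [← this]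
    simp only [Function.comp_apply, mul_comm]
  set G : ℝ → ℝ := fun θ => pertEven A B C D f (Real.sin θ) *
    Real.exp (-∫ t in (0 : ℝ)..θ, Real.cos t * radialDeriv A B f (Real.sin t)) with hG
  have hGc : Continuous G := by
    have : Continuous fun θ => ∫ t in (0 : ℝ)..θ, Real.cos t * radialDeriv A B f (Real.sin t) :=
      intervalIntegral.continuous_primitive (fun _ _ => hHs.intervalIntegrable _ _) 0
    fun_prop
  set J := Ioo (-(Real.pi / 2)) (Real.pi / 2)
  have hJ : Real.sin '' J = Ioo (-1 : ℝ) 1 := Real.sinPartialHomeomorph.image_source_eq_target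
  have hinj : InjOn Real.sin J := Real.injOn_sin.mono Ioo_subset_Icc_self
  have hder : ∀ θ ∈ J, HasDerivWithinAt Real.sin (Real.cos θ) J θ :=
    fun θ _ => (Real.hasDerivAt_sin θ).hasDerivWithinAt
  -- The powers of `cos θ` cancel: `-2` from `M`, `1` from the exponential, `1` from the Jacobian.
  -- What remains is continuous on the closed interval, which gives the convergence.
  have heq : EqOn (fun θ => |Real.cos θ| • integrand A B C D f (Real.sin θ)) G J := by
    intro θ hθ
    have hc : 0 < Real.cos θ := Real.cos_pos_of_mem_Ioo hθ
    have hs : Real.sin θ ∈ Ioo (-1 : ℝ) 1 := hJ ▸ mem_image_of_mem _ hθ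
    have h1 : 1 - Real.sin θ ^ 2 = Real.cos θ ^ 2 := by linarith [Real.sin_sq_add_cos_sq θ]
    have hlog : Real.log (1 - Real.sin θ ^ 2) / 2 = Real.log (Real.cos θ) := by
      rw [h1, Real.log_pow]; push_cast; ring
    have hM : Mfun A B C D f (Real.sin θ) = pertEven A B C D f (Real.sin θ) / Real.cos θ ^ 2 := by
      rw [← h1, pertEven, div_div, mul_comm (_ ^ 2)]; rfl
    simp only [hG, integrand, (intervalIntegrable_Lfun hf hd hs).2, hlog, hexp, hM, neg_sub,
      smul_eq_mul, abs_of_pos hc]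
    rw [sub_eq_add_neg, Real.exp_add, Real.exp_log hc]
    field_simp
  have hint : IntegrableOn (fun θ => |Real.cos θ| • integrand A B C D f (Real.sin θ)) J := by
    rw [integrableOn_congr_fun heq measurableSet_Ioo]
    exact (hGc.integrableOn_Icc).mono_set Ioo_subset_Icc_self
  have h2 : IntegrableOn (integrand A B C D f) (Ioo (-1) 1) := by
    rw [← hJ, integrableOn_image_iff_integrableOn_abs_deriv_smul measurableSet_Ioo hder hinj]
    exact hint
  refine ⟨(intervalIntegrable_iff_integrableOn_Ioo_of_le (by norm_num)).2 h2, ?_⟩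
  rw [Nfun, intervalIntegral.integral_of_le (by norm_num), integral_Ioc_eq_integral_Ioo, ← hJ,
    integral_image_eq_integral_abs_deriv_smul measurableSet_Ioo hder hinj,
    setIntegral_congr_fun measurableSet_Ioo heq, intervalIntegral.integral_of_le (by linarith),
    integral_Ioc_eq_integral_Ioo]

end

/-! ### The averaging argument -/

section

theorem exists_mem_Icc_sin_cos (θ : ℝ) :
    ∃ t ∈ Icc 0 (2 * Real.pi), Real.sin t = Real.sin θ ∧ Real.cos t = Real.cos θ := by
  have hper : Function.Periodic (fun t => (Real.sin t, Real.cos t)) (2 * Real.pi) := fun t => by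
    simp
  obtain ⟨t, ht, h⟩ := hper.exists_mem_Ico₀ Real.two_pi_pos θ
  exact ⟨t, ⟨ht.1, ht.2.le⟩, congrArg Prod.fst h.symm, congrArg Prod.snd h.symm⟩

/-- The derivative of `f` within `[-1,1]` suffices even where `sin θ = ±1`, because `sin` never
leaves that interval. -/
theorem hasDerivAt_comp_sin {A B : MvPolynomial (Fin 2) ℝ} {ρ : ℝ} {f : ℝ → ℝ}
    (hf : IsUnperturbedSolution A B ρ f) (θ : ℝ) :
    HasDerivAt (fun θ => f (Real.sin θ)) (Real.cos θ *
      (polarNum A B (f (Real.sin θ)) (Real.sin θ) (Real.cos θ) /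
        polarDen A B (f (Real.sin θ)) (Real.sin θ) (Real.cos θ))) θ := by
  have hv : Real.cos θ ^ 2 = 1 - Real.sin θ ^ 2 := Real.cos_sq' θ
  have h := (hf.2 (Real.sin θ) (Real.sin_mem_Icc θ)).2.comp (h := Real.sin) (s := univ) θ
    (Real.hasDerivAt_sin θ).hasDerivWithinAt (fun x _ => Real.sin_mem_Icc x)
  rw [hasDerivWithinAt_univ] at h
  refine h.congr_deriv ?_
  rw [polarNum, polarDen, ray_sqSubst_eq_K00 A hv, ray_sqSubst_eq_K00 B hv, hv, mul_comm]

/-- The denominators do not vanish in a tube around the unperturbed orbit. -/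
theorem exists_tube (A B C D : MvPolynomial (Fin 2) ℝ) {F : ℝ → ℝ} (hF : Continuous F)
    (hFs : ∀ s t, Real.sin s = Real.sin t → F s = F t)
    (hd : ∀ θ, polarDen A B (F θ) (Real.sin θ) (Real.cos θ) ≠ 0) :
    ∃ δ > 0, ∀ x ∈ Icc (-δ) δ, ∀ ε ∈ Icc (-δ) δ, ∀ θ,
      polarDen A B (F θ + x) (Real.sin θ) (Real.cos θ) +
        ε * angPert C D (F θ + x) (Real.sin θ) (Real.cos θ) ≠ 0 := by
  have hev : ∀ᶠ p : ℝ × ℝ in 𝓝 (0, 0), ∀ θ ∈ Icc 0 (2 * Real.pi),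
      polarDen A B (F θ + p.1) (Real.sin θ) (Real.cos θ) +
        p.2 * angPert C D (F θ + p.1) (Real.sin θ) (Real.cos θ) ≠ 0 := by
    -- Compactness of one period makes the neighbourhood of `(0, 0)` uniform in the angle.
    refine isCompact_Icc.eventually_forall_of_forall_eventually fun θ _ => ?_
    have hc : Continuous fun q : (ℝ × ℝ) × ℝ =>
        polarDen A B (F q.2 + q.1.1) (Real.sin q.2) (Real.cos q.2) +
        q.1.2 * angPert C D (F q.2 + q.1.1) (Real.sin q.2) (Real.cos q.2) := by
      fun_prop
    exact hc.continuousAt.eventually_ne (by simpa using hd θ)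
  obtain ⟨δ, hδ, h⟩ := Metric.eventually_nhds_iff.1 hev
  refine ⟨δ / 2, by positivity, fun x hx ε hε θ => ?_⟩
  obtain ⟨t, ht, hs, hc⟩ := exists_mem_Icc_sin_cos θ
  rw [← hs, ← hc, ← hFs t θ hs]
  refine h (y := (x, ε)) ?_ t ht
  rw [Prod.dist_eq, max_lt_iff, Real.dist_eq, Real.dist_eq, sub_zero, sub_zero]
  exact ⟨(abs_le.2 hx).trans_lt (by linarith), (abs_le.2 hε).trans_lt (by linarith)⟩

/-- A function of `(x₁, x₂, sin θ, cos θ)` that is continuous on a compact box is bounded. -/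
theorem exists_bound_of_trig {g : ℝ → ℝ → ℝ → ℝ} {δ : ℝ}
    (hg : ContinuousOn (fun p : ℝ × ℝ × ℝ => g p.1 p.2.1 p.2.2) (Icc (-δ) δ ×ˢ Icc (-δ) δ ×ˢ univ))
    (hper : ∀ x y s t, Real.sin s = Real.sin t → Real.cos s = Real.cos t → g x y s = g x y t) :
    ∃ K > 0, ∀ x ∈ Icc (-δ) δ, ∀ y ∈ Icc (-δ) δ, ∀ θ, |g x y θ| ≤ K := by
  obtain ⟨K, hK⟩ := ((isCompact_Icc (a := -δ) (b := δ)).prod ((isCompact_Icc (a := -δ) (b := δ)).prod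
    (isCompact_Icc (a := 0) (b := 2 * Real.pi)))).exists_bound_of_continuousOn
    (hg.mono (by gcongr; exact subset_univ _))
  refine ⟨max K 1, by positivity, fun x hx y hy θ => le_max_of_le_left ?_⟩
  obtain ⟨t, ht, hs, hc⟩ := exists_mem_Icc_sin_cos θ
  rw [← hper x y t θ hs hc]
  exact hK (x, y, t) ⟨hx, hy, ht⟩

theorem continuous_field (A B C D : MvPolynomial (Fin 2) ℝ) (ε : ℝ) :
    Continuous (field A B C D ε) := by
  unfold field
  have hA := continuous_eval_pair A (X := ℝ × ℝ) (continuous_fst.pow 2) continuous_snd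
  have hB := continuous_eval_pair B (X := ℝ × ℝ) (continuous_fst.pow 2) continuous_snd
  have hC := continuous_eval_pair C (X := ℝ × ℝ) continuous_fst continuous_snd
  have hD := continuous_eval_pair D (X := ℝ × ℝ) continuous_fst continuous_snd
  exact (hA.add (continuous_const.mul hC)).prodMk
    ((continuous_fst.mul hB).add (continuous_const.mul hD))

variable {A B C D : MvPolynomial (Fin 2) ℝ} {f : ℝ → ℝ}

/-- A star-like periodic orbit of the perturbed system satisfies the equation of the trajectories
in polar coordinates. -/
theorem hasDerivAt_of_isPeriodicOrbit_field {ε : ℝ} {ρ : ℝ → ℝ} (hpos : ∀ θ, 0 < ρ θ)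
    (hper : Function.Periodic ρ (2 * Real.pi))
    (horb : IsPeriodicOrbit (field A B C D ε) (polarCurve ρ)) {θ : ℝ}
    (h1 : polarDen A B (ρ θ) (Real.sin θ) (Real.cos θ) ≠ 0)
    (h2 : polarDen A B (ρ θ) (Real.sin θ) (Real.cos θ) +
      ε * angPert C D (ρ θ) (Real.sin θ) (Real.cos θ) ≠ 0) :
    HasDerivAt ρ (Real.cos θ * (polarNum A B (ρ θ) (Real.sin θ) (Real.cos θ) /
        polarDen A B (ρ θ) (Real.sin θ) (Real.cos θ)) +
      ε * polarPert A B C D ε (ρ θ) (Real.sin θ) (Real.cos θ)) θ := by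
  obtain ⟨e1, e2⟩ := field_polar A B C D (ε := ε) (r := ρ θ) (Real.cos_sq' θ)
  rw [← e2 h1 h2]
  exact hasDerivAt_polarCurve (continuous_field A B C D ε) hpos hper horb θ (by rwa [e1])

/-- The averaging argument: if the solutions `r(·, ε)` of the perturbed equation in polar
coordinates are `2π`-periodic and tend to the unperturbed one, then the Melnikov integral
vanishes. -/
theorem integral_pertEven_eq_zero {ρ₀ ε₀ : ℝ} {r : ℝ → ℝ → ℝ}
    (hf : IsUnperturbedSolution A B ρ₀ f) (hε₀ : 0 < ε₀)
    (hr : ∀ ε ∈ Ioo 0 ε₀, Continuous fun θ => r θ ε)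
    (hrper : ∀ ε ∈ Ioo 0 ε₀, Function.Periodic (fun θ => r θ ε) (2 * Real.pi))
    (hode : ∀ ε ∈ Ioo 0 ε₀, ∀ θ, polarDen A B (r θ ε) (Real.sin θ) (Real.cos θ) ≠ 0 →
      polarDen A B (r θ ε) (Real.sin θ) (Real.cos θ) +
        ε * angPert C D (r θ ε) (Real.sin θ) (Real.cos θ) ≠ 0 →
      HasDerivAt (fun θ => r θ ε) (Real.cos θ * (polarNum A B (r θ ε) (Real.sin θ) (Real.cos θ) /
          polarDen A B (r θ ε) (Real.sin θ) (Real.cos θ)) +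
        ε * polarPert A B C D ε (r θ ε) (Real.sin θ) (Real.cos θ)) θ)
    (hlim : Tendsto (fun ε => r 0 ε) (𝓝[>] 0) (𝓝 ρ₀)) :
    ∫ θ in (-(Real.pi / 2))..(Real.pi / 2), pertEven A B C D f (Real.sin θ) *
        Real.exp (-∫ t in (0 : ℝ)..θ, Real.cos t * radialDeriv A B f (Real.sin t)) = 0 := by
  have hfc : ContinuousOn f (Icc (-1) 1) := fun u hu => (hf.2 u hu).2.continuousWithinAt
  obtain ⟨F, hFf⟩ : ∃ F : ℝ → ℝ, F = fun θ => f (Real.sin θ) := ⟨_, rfl⟩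
  have hFs : ∀ s t, Real.sin s = Real.sin t → F s = F t := fun s t h => by simp only [hFf, h]
  have hFc : Continuous F := hFf ▸ hfc.comp_continuous Real.continuous_sin Real.sin_mem_Icc
  have hF' : ∀ θ, HasDerivAt F (Real.cos θ * (polarNum A B (F θ) (Real.sin θ) (Real.cos θ) /
      polarDen A B (F θ) (Real.sin θ) (Real.cos θ))) θ := by
    subst hFf; exact hasDerivAt_comp_sin hf
  have hd0 : ∀ θ, polarDen A B (F θ) (Real.sin θ) (Real.cos θ) ≠ 0 := by
    intro θ
    have hv : Real.cos θ ^ 2 = 1 - Real.sin θ ^ 2 := Real.cos_sq' θ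
    rw [hFf, polarDen, ray_sqSubst_eq_K00 A hv, ray_sqSubst_eq_K00 B hv, hv]
    exact (hf.2 _ (Real.sin_mem_Icc θ)).1
  obtain ⟨δ, hδ, htube⟩ := exists_tube A B C D hFc hFs hd0
  have htube0 : ∀ x ∈ Icc (-δ) δ, ∀ θ,
      polarDen A B (F θ + x) (Real.sin θ) (Real.cos θ) ≠ 0 := fun x hx θ => by
    simpa using htube x hx 0 ⟨by linarith, hδ.le⟩ θ
  obtain ⟨w, hwc, hw, hwself⟩ := exists_slope A B
  -- the slope of the unperturbed equation and the perturbation, in the tube around `F`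
  let α : ℝ → ℝ → ℝ → ℝ := fun x y θ => Real.cos θ *
    (w (F θ + x, F θ + y, Real.sin θ, Real.cos θ) /
      (polarDen A B (F θ + x) (Real.sin θ) (Real.cos θ) *
        polarDen A B (F θ + y) (Real.sin θ) (Real.cos θ)))
  let τ : ℝ → ℝ → ℝ → ℝ := fun ε x θ => polarPert A B C D ε (F θ + x) (Real.sin θ) (Real.cos θ)
  have hα : ContinuousOn (fun p : ℝ × ℝ × ℝ => α p.1 p.2.1 p.2.2)
      (Icc (-δ) δ ×ˢ Icc (-δ) δ ×ˢ univ) := by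
    refine ContinuousOn.mul (Continuous.continuousOn (by fun_prop)) (ContinuousOn.div
      (Continuous.continuousOn (by fun_prop)) (Continuous.continuousOn (by fun_prop)) ?_)
    exact fun p hp => mul_ne_zero (htube0 _ hp.1 _) (htube0 _ hp.2.1 _)
  have hτ : ContinuousOn (fun p : ℝ × ℝ × ℝ => τ p.1 p.2.1 p.2.2)
      (Icc (-δ) δ ×ˢ Icc (-δ) δ ×ˢ univ) :=
    continuousOn_polarPert A B C D (by fun_prop) (by fun_prop) (by fun_prop) (by fun_prop)
      (fun p hp => htube0 _ hp.2.1 _) (fun p hp => htube _ hp.2.1 _ hp.1 _)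
  obtain ⟨K, hK, hαK⟩ := exists_bound_of_trig hα fun x y s t h1 h2 => by
    simp only [α, h1, h2, hFs s t h1]
  obtain ⟨M, hM, hτM⟩ := exists_bound_of_trig hτ fun x y s t h1 h2 => by
    simp only [τ, h1, h2, hFs s t h1]
  have hnhds : ∀ θ : ℝ, Icc (-δ) δ ×ˢ Icc (-δ) δ ×ˢ univ ∈ 𝓝 ((0 : ℝ), (0 : ℝ), θ) := fun θ =>
    prod_mem_nhds (Icc_mem_nhds (by linarith) hδ)
      (prod_mem_nhds (Icc_mem_nhds (by linarith) hδ) univ_mem)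
  let y : ℝ → ℝ → ℝ := fun ε θ => r θ ε - F θ
  have hry : ∀ ε θ, r θ ε = F θ + y ε θ := fun ε θ => by simp only [y]; ring
  have hmem : ∀ x, |x| < δ → x ∈ Icc (-δ) δ := fun x hx => abs_le.1 hx.le
  have h0mem : (0 : ℝ) ∈ Icc (-δ) δ := ⟨by linarith, hδ.le⟩
  have hε : ∀ᶠ ε in 𝓝[>] (0 : ℝ), ε ∈ Ioo 0 ε₀ := Ioo_mem_nhdsGT hε₀
  have hεδ : ∀ᶠ ε in 𝓝[>] (0 : ℝ), ε ∈ Icc (-δ) δ :=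
    mem_of_superset (Ioo_mem_nhdsGT hδ) fun ε h => ⟨by linarith [h.1], h.2.le⟩
  have hFper : Function.Periodic F (2 * Real.pi) := fun θ => hFs _ _ (Real.sin_add_two_pi θ)
  have hyc : ∀ᶠ ε in 𝓝[>] (0 : ℝ), Continuous (y ε) := hε.mono fun ε h => (hr ε h).sub hFc
  have hrder : ∀ᶠ ε in 𝓝[>] (0 : ℝ), ∀ θ, |y ε θ| < δ →
      HasDerivAt (fun θ => r θ ε)
        (Real.cos θ * (polarNum A B (F θ + y ε θ) (Real.sin θ) (Real.cos θ) /
          polarDen A B (F θ + y ε θ) (Real.sin θ) (Real.cos θ)) + ε * τ ε (y ε θ) θ) θ := by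
    filter_upwards [hε, hεδ] with ε hε hεδ θ hθ
    have := hode ε hε θ
    rw [hry] at this
    exact this (htube0 _ (hmem _ hθ) θ) (htube _ (hmem _ hθ) _ hεδ θ)
  have hsub : ∀ x ∈ Icc (-δ) δ, ∀ x' ∈ Icc (-δ) δ, ∀ θ,
      Real.cos θ * (polarNum A B (F θ + x) (Real.sin θ) (Real.cos θ) /
          polarDen A B (F θ + x) (Real.sin θ) (Real.cos θ)) -
        Real.cos θ * (polarNum A B (F θ + x') (Real.sin θ) (Real.cos θ) /
          polarDen A B (F θ + x') (Real.sin θ) (Real.cos θ)) = α x x' θ * (x - x') := by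
    intro x hx x' hx' θ
    rw [← mul_sub, hw _ _ _ _ (htube0 x hx θ) (htube0 x' hx' θ)]
    simp only [α]
    ring
  have hα0 : ∀ θ, α 0 0 θ = Real.cos θ * radialDeriv A B f (Real.sin θ) := by
    intro θ
    -- The diagonal value of `w` is known only for `v ≠ 0`; at `cos θ = 0` the prefactor kills both
    -- sides.
    by_cases hc : Real.cos θ = 0
    · simp only [α, hc, zero_mul]
    have hv : Real.cos θ ^ 2 = 1 - Real.sin θ ^ 2 := Real.cos_sq' θ
    simp only [α, add_zero]
    rw [hwself _ _ _ hv hc, radialDeriv, polarDen, ray_sqSubst_eq_K00 A hv,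
      ray_sqSubst_eq_K00 B hv, hv, hFf]
    congr 2
    ring
  have hτ0 : ∀ θ, τ 0 0 θ + τ 0 0 (Real.pi - θ) = 2 * pertEven A B C D f (Real.sin θ) := by
    intro θ
    simp only [τ, Real.sin_pi_sub, Real.cos_pi_sub, add_zero,
      hFs (Real.pi - θ) θ (Real.sin_pi_sub θ)]
    rw [polarPert_zero_add_neg A B C D (Real.cos_sq' θ), hFf]
    rfl
  have hyper : ∀ᶠ ε in 𝓝[>] (0 : ℝ), Function.Periodic (y ε) (2 * Real.pi) :=
    hε.mono fun ε h => (hrper ε h).sub hFper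
  have hy0 : Tendsto (fun ε => y ε 0) (𝓝[>] 0) (𝓝 0) := by
    have : F 0 = ρ₀ := by rw [hFf]; simpa using hf.1
    simpa [y, this] using hlim.sub_const ρ₀
  clear_value α τ
  have hsmall : ∀ η > 0, ∀ᶠ ε in 𝓝[>] (0 : ℝ), ∀ θ, |y ε θ| < η := by
    intro η hη
    -- `F` solves the unperturbed equation, so in the tube the deviation satisfies `y' = α(y, 0) y +
    -- ε τ`.
    refine eventually_forall_abs_lt (y' := fun ε θ => α (y ε θ) 0 θ * y ε θ + ε * τ ε (y ε θ) θ)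
      Real.two_pi_pos hδ hK hM.le hyc hyper ?_ hy0 hη
    filter_upwards [hε, hεδ, hrder] with ε hε hεδ hrder θ hθ
    refine ⟨((hrder θ hθ).fun_sub (hF' θ)).congr_deriv ?_, ?_⟩
    · have := hsub _ (hmem _ hθ) 0 h0mem θ
      rw [add_zero, sub_zero] at this
      linear_combination this
    · refine (abs_add_le _ _).trans ?_
      rw [abs_mul, abs_mul, abs_of_pos hε.1]
      have h1 := hαK _ (hmem _ hθ) 0 h0mem θ
      have h2 := hτM ε hεδ _ (hmem _ hθ) θ
      have := hε.1.le
      gcongr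
  clear_value y
  have hylim : ∀ θ, Tendsto (fun ε => y ε θ) (𝓝[>] 0) (𝓝 0) := fun θ =>
    Metric.tendsto_nhds.2 fun η hη => (hsmall η hη).mono fun ε h => by
      simpa [Real.dist_eq] using h θ
  have hid : Tendsto (fun ε : ℝ => ε) (𝓝[>] 0) (𝓝 0) := tendsto_id.mono_left nhdsWithin_le_nhds
  -- The orbit is compared with its own mirror image rather than with `F`, so the coefficient is the
  -- slope between the radii at `θ` and `π - θ`.
  have hmain := integral_mul_exp_eq_zero_of_tendsto
    (z := fun ε θ => r θ ε - r (Real.pi - θ) ε)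
    (a := fun ε θ => α (y ε θ) (y ε (Real.pi - θ)) θ)
    (b := fun ε θ => τ ε (y ε θ) θ + τ ε (y ε (Real.pi - θ)) (Real.pi - θ))
    (a₀ := fun θ => α 0 0 θ) (b₀ := fun θ => τ 0 0 θ + τ 0 0 (Real.pi - θ))
    (α := -(Real.pi / 2)) (β := Real.pi / 2) (Ka := K) (Kb := M + M) ?_ ?_ ?_ ?_ ?_ ?_ ?_ ?_ ?_
  · simp only [hα0, hτ0, mul_assoc, intervalIntegral.integral_const_mul] at hmain
    simpa using hmain
  · filter_upwards [hyc, hsmall δ hδ] with ε hyc hs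
    exact hα.comp_continuous (f := fun θ => (y ε θ, y ε (Real.pi - θ), θ)) (by fun_prop)
      fun θ => ⟨hmem _ (hs θ), hmem _ (hs _), mem_univ _⟩
  · filter_upwards [hyc, hsmall δ hδ, hεδ] with ε hyc hs hε
    exact (hτ.comp_continuous (f := fun θ => (ε, y ε θ, θ)) (by fun_prop)
        fun θ => ⟨hε, hmem _ (hs θ), mem_univ _⟩).add
      (hτ.comp_continuous (f := fun θ => (ε, y ε (Real.pi - θ), Real.pi - θ)) (by fun_prop)
        fun θ => ⟨hε, hmem _ (hs _), mem_univ _⟩)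
  -- Differentiating `r (π - θ)` gives a minus sign, and so does `cos (π - θ)`. They cancel in the
  -- unperturbed term, which is thus subtracted, while the perturbation terms add up.
  · filter_upwards [hrder, hsmall δ hδ] with ε hrder hs θ
    have h1 := hrder θ (hs θ)
    have h2 := (hrder (Real.pi - θ) (hs _)).comp_const_sub Real.pi θ
    refine (h1.fun_sub h2).congr_deriv ?_
    have h3 := hsub _ (hmem _ (hs θ)) _ (hmem _ (hs (Real.pi - θ))) θ
    simp only [hry]
    rw [hFs (Real.pi - θ) θ (Real.sin_pi_sub θ), Real.sin_pi_sub, Real.cos_pi_sub, polarDen_neg,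
      polarNum_neg]
    linear_combination h3
  -- The mirror image of `-π/2` is `3π/2 = -π/2 + 2π`; at the other end `π/2` is its own image.
  · filter_upwards [hε] with ε hε
    have := hrper ε hε (-(Real.pi / 2))
    simp only at this
    rw [← this]
    ring_nf
  · refine Eventually.of_forall fun ε => ?_
    ring_nf
  · filter_upwards [hsmall δ hδ] with ε hs θ
    exact hαK _ (hmem _ (hs _)) _ (hmem _ (hs _)) _
  · filter_upwards [hsmall δ hδ, hεδ] with ε hs hε θ
    exact (abs_add_le _ _).trans
      (add_le_add (hτM _ hε _ (hmem _ (hs _)) _) (hτM _ hε _ (hmem _ (hs _)) _))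
  · exact fun θ => ((hα.continuousAt (hnhds θ)).tendsto).comp
      ((hylim θ).prodMk_nhds ((hylim _).prodMk_nhds tendsto_const_nhds))
  · intro θ
    exact (((hτ.continuousAt (hnhds θ)).tendsto).comp
      (hid.prodMk_nhds ((hylim _).prodMk_nhds tendsto_const_nhds))).add
      (((hτ.continuousAt (hnhds (Real.pi - θ))).tendsto).comp
      (hid.prodMk_nhds ((hylim _).prodMk_nhds tendsto_const_nhds)))

end

end RevCenter

/-! ### The main theorem -/

theorem theorem1p2 (A B C D : MvPolynomial (Fin 2) ℝ)
    -- the angular velocity of the unperturbed system does not vanish near the origin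
    (hU : ∀ᶠ p in 𝓝[≠] (0 : ℝ × ℝ),
      p.1 ^ 2 * MvPolynomial.eval ![p.1 ^ 2, p.2] B - p.2 * MvPolynomial.eval ![p.1 ^ 2, p.2] A ≠ 0)
    (hC : MvPolynomial.eval ![0, 0] C = 0) (hD : MvPolynomial.eval ![0, 0] D = 0)
    -- the star-like periodic orbit `r = f(sin θ)`, `f = f_ρ₀`, of the unperturbed system
    (ρ₀ : ℝ) (hρ₀ : 0 < ρ₀) (f : ℝ → ℝ) (hf : RevCenter.IsUnperturbedSolution A B ρ₀ f)
    (hfpos : ∀ u ∈ Icc (-1 : ℝ) 1, 0 < f u)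
    (horb : RevCenter.IsPeriodicOrbit (RevCenter.field A B C D 0)
      (RevCenter.polarCurve fun θ => f (Real.sin θ)))
    -- the continuous family of limit cycles `r = r(θ, ε)` of the perturbed system
    (ε₀ : ℝ) (hε₀ : 0 < ε₀) (r : ℝ → ℝ → ℝ)
    (hrcont : ContinuousOn (fun p : ℝ × ℝ => r p.1 p.2) (univ ×ˢ Ioo 0 ε₀))
    (hrpos : ∀ ε ∈ Ioo 0 ε₀, ∀ θ, 0 < r θ ε)
    (hrper : ∀ ε ∈ Ioo 0 ε₀, Function.Periodic (fun θ => r θ ε) (2 * Real.pi))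
    (hlc : ∀ ε ∈ Ioo 0 ε₀, RevCenter.IsLimitCycle (RevCenter.field A B C D ε)
      (RevCenter.polarCurve fun θ => r θ ε))
    (hlim : Tendsto (fun ε => r 0 ε) (𝓝[>] 0) (𝓝 ρ₀)) :
    (∀ u ∈ Ioo (-1 : ℝ) 1, IntervalIntegrable (RevCenter.Lfun A B f) volume 0 u) ∧
      IntervalIntegrable (RevCenter.integrand A B C D f) volume (-1) 1 ∧
      RevCenter.Nfun A B C D f = 0 := by
  have hfc : ContinuousOn f (Icc (-1) 1) := fun u hu => (hf.2 u hu).2.continuousWithinAt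
  have hden : ∀ u ∈ Icc (-1 : ℝ) 1,
      u * RevCenter.K00 A (f u) u - (1 - u ^ 2) * RevCenter.K00 B (f u) u * f u ≠ 0 :=
    fun u hu h => (hf.2 u hu).1 (by linarith)
  obtain ⟨hint, hN⟩ := RevCenter.Nfun_eq (C := C) (D := D) hfc hden
  refine ⟨fun u hu => (RevCenter.intervalIntegrable_Lfun hfc hden hu).1, hint, ?_⟩
  rw [hN]
  have hr : ∀ ε ∈ Ioo 0 ε₀, Continuous fun θ => r θ ε := fun ε hε =>
    hrcont.comp_continuous (f := fun θ : ℝ => (θ, ε)) (by fun_prop) fun θ => ⟨mem_univ _, hε⟩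
  exact RevCenter.integral_pertEven_eq_zero hf hε₀ hr hrper (fun ε hε θ h1 h2 =>
    RevCenter.hasDerivAt_of_isPeriodicOrbit_field (hrpos ε hε) (hrper ε hε) (hlc ε hε).1 h1 h2) hlim
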